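/- Let $\Gamma_2=\mathrm{Sp}(2,\mathbb Z)$, with elements written in $2\times2$ blocks $M=\begin{pmatrix}A&B\\C&D\end{pmatrix}$, acting on the Siegel upper half plane $\mathbb H_2$ of complex symmetric $2\times2$ matrices with positive definite imaginary part by $MZ=(AZ+B)(CZ+D)^{-1}$. Let $E$ be the $2\times 2$ unit matrix, let $\Gamma_2[l]=\ker(\mathrm{Sp}(2,\mathbb Z)\to\mathrm{Sp}(2,\mathbb Z/l\mathbb Z))$ and let $\Gamma_{2,0}[l]=\{M\in\Gamma_2 : C\equiv0 \bmod l\}$. For a characteristic $m=\binom ab$ with $a,b\in(\mathbb Z/2\mathbb Z)^2$ (where $\mathbb Z/2\mathbb Z$ is identified with $\{0,1\}\subset\mathbb Z$), put $$\vartheta[m](Z)=\sum_{g\in\mathbb Z^2}\exp\bigl(\pi i\,({}^t(g+a/2)\,Z\,(g+a/2)+{}^tb(g+a/2))\bigr);$$ $m$ is called even if ${}^tab=0$ in $\mathbb Z/2\mathbb Z$. The standard syzygetic quadruple consists of the four even characteristics with $a=0$; let $\mathfrak n$ be the set of the six remaining even characteristics, and put $T=\prod_{m\in\mathfrak n}\vartheta[m]$.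 For $M\in\Gamma_{2,0}[2]$ let $\chi_{\mathfrak n}(M)$ denote the multiplier of $T$ in weight $3$, so that $\chi_{\mathfrak n}(M)=1$ means $$T(MZ)=\det(CZ+D)^3\,T(Z)\quad\text{for all } Z\in\mathbb H_2.$$ Put $\Gamma_{2,0}[2]_{\mathfrak n}=\{M\in\Gamma_{2,0}[2] : \chi_{\mathfrak n}(M)=1\}$ and $\Gamma=\{M\in\Gamma_2[2] : \chi_{\mathfrak n}(M)=1\}$. **Lemma.** For every $M\in\Gamma_2[2]$ the matrix $C\,{}^tD=\begin{pmatrix}\alpha&\beta\\\beta&\gamma\end{pmatrix}$ is symmetric, and $M\in\Gamma$ if and only if $\alpha+\beta+\gamma\equiv0\bmod4$. Moreover, $\Gamma$ is the subgroup of $\Gamma_2$ generated by the following elements: 1. the elements of $\Gamma_2[4]$; 2. the elements of $\Gamma_{2,0}[2]_{\mathfrak n}$ that are conjugate in $\Gamma_2$ to the diagonal matrix with diagonal $(1,-1,1,-1)$; 3. the elements of $\Gamma_{2,0}[2]_{\mathfrak n}$ that are conjugate in $\Gamma_2$ to a translation matrix $\begin{pmatrix}E&S\\0&E\end{pmatrix}$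 belonging to $\Gamma_2[2]$. -/

import Mathlib

namespace SiegelTwo

open Matrix

/-- The Siegel modular group `Γ₂ = Sp(2, ℤ)`. -/
abbrev Gamma2 : Type := symplecticGroup (Fin 2) ℤ

/-- The reduction homomorphism `Sp(2, ℤ) → Sp(2, ℤ/lℤ)`. -/
def reduction (l : ℕ) : Gamma2 →* symplecticGroup (Fin 2) (ZMod l) where
  toFun M := ⟨M.1.map (Int.castRingHom (ZMod l)), SymplecticGroup.map_mem M.2 _⟩
  map_one' := by
    apply Subtype.ext
    simp
  map_mul' M N := by
    apply Subtype.ext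
    exact Matrix.map_mul

/-- The principal congruence subgroup `Γ₂[l]`. -/
def principal (l : ℕ) : Subgroup Gamma2 := (reduction l).ker

/-- The group `Γ_{2,0}[l]`: the matrices in `Γ₂` with lower left block `C ≡ 0 mod l`. -/
def hecke (l : ℕ) : Set Gamma2 := {M | ∀ i j, (l : ℤ) ∣ M.1.toBlocks₂₁ i j}

/-- The Siegel upper half plane `ℍ₂`: complex symmetric `2 × 2` matrices with positive definite
imaginary part. -/
def upperHalf : Set (Matrix (Fin 2) (Fin 2) ℂ) := {Z | Z.IsSymm ∧ (Z.map Complex.im).PosDef}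

/-- An integral matrix regarded as a complex one. -/
def toC (A : Matrix (Fin 2) (Fin 2) ℤ) : Matrix (Fin 2) (Fin 2) ℂ := A.map (Int.cast : ℤ → ℂ)

/-- The matrix `CZ + D`. -/
noncomputable def denom (M : Gamma2) (Z : Matrix (Fin 2) (Fin 2) ℂ) : Matrix (Fin 2) (Fin 2) ℂ :=
  toC M.1.toBlocks₂₁ * Z + toC M.1.toBlocks₂₂

/-- The action `MZ = (AZ + B)(CZ + D)⁻¹`. -/
noncomputable def act (M : Gamma2) (Z : Matrix (Fin 2) (Fin 2) ℂ) : Matrix (Fin 2) (Fin 2) ℂ :=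
  (toC M.1.toBlocks₁₁ * Z + toC M.1.toBlocks₁₂) * (denom M Z)⁻¹

/-- Theta characteristics `m = (a, b)` with `a, b ∈ (ℤ/2ℤ)²`. -/
abbrev ThetaChar : Type := (Fin 2 → ZMod 2) × (Fin 2 → ZMod 2)

/-- The even characteristics: those with `ᵗa b = 0`. -/
def evenChars : Finset ThetaChar := Finset.univ.filter fun m => m.1 ⬝ᵥ m.2 = 0

/-- The standard syzygetic quadruple. -/
def standardQuadruple : Finset ThetaChar :=
  {(![0, 0], ![0, 0]), (![0, 0], ![1, 0]), (![0, 0], ![0, 1]), (![0, 0], ![1, 1])}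

/-- The sextuple of even characteristics complementary to the standard syzygetic quadruple. -/
def standardSextuple : Finset ThetaChar := evenChars \ standardQuadruple

/-- The shifted lattice vector `g + a/2`, where `ℤ/2ℤ` is identified with `{0, 1}`. -/
noncomputable def shifted (a : Fin 2 → ZMod 2) (g : Fin 2 → ℤ) : Fin 2 → ℂ :=
  fun i => (g i : ℂ) + ((a i).val : ℂ) / 2

/-- The theta function `ϑ[m](Z) = ∑_{g ∈ ℤ²} exp (π i (Z[g + a/2] + ᵗb (g + a/2)))`, where
`Z[v] = ᵗv Z v`. -/
noncomputable def theta (m : ThetaChar) (Z : Matrix (Fin 2) (Fin 2) ℂ) : ℂ :=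
  ∑' g : Fin 2 → ℤ, Complex.exp (Real.pi * Complex.I *
    (shifted m.1 g ⬝ᵥ (Z *ᵥ shifted m.1 g) +
      (fun i => ((m.2 i).val : ℂ)) ⬝ᵥ shifted m.1 g))

/-- The product of theta functions `T_𝔫 = ∏_{m ∈ 𝔫} ϑ[m]`. -/
noncomputable def thetaProd (n : Finset ThetaChar) (Z : Matrix (Fin 2) (Fin 2) ℂ) : ℂ :=
  ∏ m ∈ n, theta m Z

/-- `χ_𝔫(M) = c`, for the multiplier `χ_𝔫` of `T_𝔫` in weight `3`:
`T_𝔫(MZ) = c · det(CZ + D)³ · T_𝔫(Z)` on `ℍ₂`. -/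
def HasMultiplier (n : Finset ThetaChar) (M : Gamma2) (c : ℂ) : Prop :=
  ∀ Z ∈ upperHalf, thetaProd n (act M Z) = c * (denom M Z).det ^ 3 * thetaProd n Z

/-- The group `Γ_{2,0}[2]_𝔫`, the kernel of `χ_𝔫` on `Γ_{2,0}[2]`. -/
def heckeKer (n : Finset ThetaChar) : Set Gamma2 := {M | M ∈ hecke 2 ∧ HasMultiplier n M 1}

/-- The group `Γ_𝔫`, the kernel of `χ_𝔫` on `Γ₂[2]`. -/
def Gamma (n : Finset ThetaChar) : Set Gamma2 := {M | M ∈ principal 2 ∧ HasMultiplier n M 1}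

/-- The diagonal matrix with diagonal `(1, -1, 1, -1)`, as an element of `Γ₂`. -/
def diagElt : Gamma2 :=
  ⟨fromBlocks (diagonal ![1, -1]) 0 0 (diagonal ![1, -1]), by
    rw [SymplecticGroup.mem_iff]
    decide⟩

/-- The translation matrices `(E S; 0 E)` in `Γ₂`. -/
def IsTranslation (N : Gamma2) : Prop :=
  ∃ S : Matrix (Fin 2) (Fin 2) ℤ, N.1 = fromBlocks 1 S 0 1

end SiegelTwo

/-!
The kernel of the multiplier `χ` of `T = ∏ ϑ[m]` (the six even characteristics with `a ≠ 0`) on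
`Γ₂[2]` is determined in two steps.

*The multiplier.* The relation `Carries M n n' c`, saying that `M` takes the theta product over `n`
to that over `n'` up to the constant `c` and the automorphy factor of weight three, composes along
products of matrices. A Euclidean algorithm with even quotients on the first two columns shows
that `Γ₂[2]` is generated by the even translations `(E S; 0 E)`, their transposes, and the matrices
`(U 0; 0 ᵗU⁻¹)` with `U ≡ 1 mod 2` (`closure_evenGenerators`). For the first and the last kind,
`χ = 1` follows from a substitution in the theta series. A transposed translation is the conjugate
of a translation under `Z ↦ -Z⁻¹`, which exchanges `a` and `b` in the characteristics; the unknown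
constant of the inversion formula cancels in the conjugation, and the value
`χ = (-1) ^ (p + q + r)` for `C = 2 (p q; q r)` is read off from translating the product over the
characteristics with `b ≠ 0` (`carries_lower`). The inversion `Z ↦ -Z⁻¹` is composed of inversions
in one variable, for which the functional equation of the Jacobi theta function suffices.

Modulo `4`, multiplication in `Γ₂[2]` is addition of the differences from the unit matrix. Hence
`α + β + γ mod 4` is a homomorphism on `Γ₂[2]`, and `χ(M) = (-1) ^ ((α + β + γ) / 2)`. That this
number is `1` only for `α + β + γ ≡ 0 mod 4` requires `T ≠ 0` (`exists_thetaProd_ne_zero`): on a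
suitable complex line each of the six factors is an analytic function, and at one of two points of
the line all terms of its series have the same phase.

*Generators of the kernel.* By the same additivity, `Γ / Γ₂[4]` consists of the matrices
`1 + 2 (a b; c -ᵗa)` modulo `4` with `b`, `c` symmetric modulo `2` and `c₁₁ + c₁₂ + c₂₂` even.
The part `b` comes from translations in `Γ₂[2]`, the part `c` from their conjugates, and the part
`a` from four reflections conjugate to `diag(1, -1)` in `GL₂(ℤ)`.
-/

namespace SiegelTwo

open Matrix

/-! ### The action on the Siegel upper half plane -/

section Action

open scoped ComplexOrder

lemma block_relations (M : Gamma2) :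
    M.1.toBlocks₁₁ᵀ * M.1.toBlocks₂₁ = M.1.toBlocks₂₁ᵀ * M.1.toBlocks₁₁ ∧
    M.1.toBlocks₁₂ᵀ * M.1.toBlocks₂₂ = M.1.toBlocks₂₂ᵀ * M.1.toBlocks₁₂ ∧
    M.1.toBlocks₁₁ᵀ * M.1.toBlocks₂₂ - M.1.toBlocks₂₁ᵀ * M.1.toBlocks₁₂ = 1 := by
  have h := M.2
  rw [← fromBlocks_toBlocks M.1] at h
  exact SymplecticGroup.fromBlocks_mem_iff.1 h

lemma toC_mul (A B : Matrix (Fin 2) (Fin 2) ℤ) : toC (A * B) = toC A * toC B :=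
  Matrix.map_mul (f := Int.castRingHom ℂ)

lemma toC_add (A B : Matrix (Fin 2) (Fin 2) ℤ) : toC (A + B) = toC A + toC B := by
  ext i j; simp [toC]

lemma toC_one : toC 1 = 1 := by
  simp [toC]

lemma toC_transpose (A : Matrix (Fin 2) (Fin 2) ℤ) : toC Aᵀ = (toC A)ᵀ := rfl

lemma toC_conjTranspose (A : Matrix (Fin 2) (Fin 2) ℤ) : (toC A)ᴴ = (toC A)ᵀ := by
  ext i j; simp [toC]

/-- The numerator `AZ + B` of the action. -/
noncomputable def numer (M : Gamma2) (Z : Matrix (Fin 2) (Fin 2) ℂ) : Matrix (Fin 2) (Fin 2) ℂ :=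
  toC M.1.toBlocks₁₁ * Z + toC M.1.toBlocks₁₂

lemma act_eq (M : Gamma2) (Z : Matrix (Fin 2) (Fin 2) ℂ) : act M Z = numer M Z * (denom M Z)⁻¹ :=
  rfl

lemma toC_block_relations (M : Gamma2) :
    (toC M.1.toBlocks₁₁)ᵀ * toC M.1.toBlocks₂₁ = (toC M.1.toBlocks₂₁)ᵀ * toC M.1.toBlocks₁₁ ∧
    (toC M.1.toBlocks₁₂)ᵀ * toC M.1.toBlocks₂₂ = (toC M.1.toBlocks₂₂)ᵀ * toC M.1.toBlocks₁₂ ∧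
    (toC M.1.toBlocks₁₁)ᵀ * toC M.1.toBlocks₂₂ =
      1 + (toC M.1.toBlocks₂₁)ᵀ * toC M.1.toBlocks₁₂ ∧
    (toC M.1.toBlocks₂₂)ᵀ * toC M.1.toBlocks₁₁ =
      1 + (toC M.1.toBlocks₁₂)ᵀ * toC M.1.toBlocks₂₁ := by
  obtain ⟨h1, h2, h3⟩ := block_relations M
  have h1' := congrArg toC h1
  have h2' := congrArg toC h2
  have h3' := congrArg toC (sub_eq_iff_eq_add.1 h3)
  simp only [toC_mul, toC_add, toC_one, toC_transpose] at h1' h2' h3'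
  refine ⟨h1', h2', h3', ?_⟩
  simpa using congrArg transpose h3'

lemma expand_mul {R : Type*} [Ring R] (z a b c d y : R) :
    (y * a + b) * (c * z + d) = y * (a * c) * z + y * (a * d) + (b * c) * z + b * d := by
  noncomm_ring

lemma transpose_numer_mul_denom (M : Gamma2) {Z : Matrix (Fin 2) (Fin 2) ℂ} (hZ : Z.IsSymm) :
    (numer M Z)ᵀ * denom M Z = (denom M Z)ᵀ * numer M Z := by
  obtain ⟨h1, h2, h3, h4⟩ := toC_block_relations M
  simp only [numer, denom, transpose_add, transpose_mul, hZ.eq, expand_mul]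
  rw [h1, h2, h3, h4]
  simp only [mul_add, add_mul, mul_one, one_mul]
  abel

lemma conjTranspose_denom_mul_numer (M : Gamma2) (Z : Matrix (Fin 2) (Fin 2) ℂ) :
    (denom M Z)ᴴ * numer M Z - (numer M Z)ᴴ * denom M Z = Z - Zᴴ := by
  obtain ⟨h1, h2, h3, h4⟩ := toC_block_relations M
  simp only [numer, denom, conjTranspose_add, conjTranspose_mul, toC_conjTranspose, expand_mul]
  rw [h1, h2, h3, h4]
  simp only [mul_add, add_mul, mul_one, one_mul]
  abel

lemma sub_conjTranspose_of_isSymm {Z : Matrix (Fin 2) (Fin 2) ℂ} (hZ : Z.IsSymm) :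
    Z - Zᴴ = (2 * Complex.I) • (Z.map Complex.im).map Complex.ofReal := by
  ext i j
  have : Z j i = Z i j := hZ.apply i j
  apply Complex.ext <;> simp [this]
  all_goals ring

lemma posDef_map_ofReal_iff {Y : Matrix (Fin 2) (Fin 2) ℝ} :
    (Y.map Complex.ofReal).PosDef ↔ Y.PosDef := by
  constructor
  · intro h
    refine .of_dotProduct_mulVec_pos ?_ fun x hx => ?_
    · ext i j
      have := congrFun (congrFun h.1 i) j
      simpa using this
    · have hx' : (fun i => (x i : ℂ)) ≠ 0 := fun h0 => hx <| by
        ext i; simpa using congrFun h0 i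
      have := h.dotProduct_mulVec_pos hx'
      rw [← Complex.zero_lt_real]
      convert this using 1
      simp [dotProduct, mulVec, Fin.sum_univ_two]
  · intro h
    refine .of_dotProduct_mulVec_pos ?_ fun x hx => ?_
    · ext i j
      have := congrFun (congrFun h.1 i) j
      simpa using congrArg Complex.ofReal this
    · have hs : Y 1 0 = Y 0 1 := by simpa using congrFun (congrFun h.1 0) 1
      have key : star x ⬝ᵥ (Y.map Complex.ofReal *ᵥ x) =
          (((fun i => (x i).re) ⬝ᵥ (Y *ᵥ fun i => (x i).re) +
            (fun i => (x i).im) ⬝ᵥ (Y *ᵥ fun i => (x i).im) : ℝ) : ℂ) := by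
        apply Complex.ext <;> simp [dotProduct, mulVec, Fin.sum_univ_two, hs] <;> ring
      rw [key, Complex.zero_lt_real]
      have hre := h.posSemidef.dotProduct_mulVec_nonneg fun i => (x i).re
      have him := h.posSemidef.dotProduct_mulVec_nonneg fun i => (x i).im
      by_cases h0 : (fun i => (x i).re) = 0
      · have h1 : (fun i => (x i).im) ≠ 0 := fun h1 => hx <| by
          ext i; exact Complex.ext (congrFun h0 i) (congrFun h1 i)
        exact add_pos_of_nonneg_of_pos hre (h.dotProduct_mulVec_pos h1)
      · exact add_pos_of_pos_of_nonneg (h.dotProduct_mulVec_pos h0) him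

/-- A kernel vector `v` of `CZ + D` would satisfy `v* (Im Z) v = 0`. -/
lemma isUnit_det_denom (M : Gamma2) {Z : Matrix (Fin 2) (Fin 2) ℂ} (hZ : Z ∈ upperHalf) :
    IsUnit (denom M Z).det := by
  rw [isUnit_iff_ne_zero]
  intro h0
  obtain ⟨v, hv, hv0⟩ := exists_mulVec_eq_zero_iff.2 h0
  have h := conjTranspose_denom_mul_numer M Z
  rw [sub_conjTranspose_of_isSymm hZ.1] at h
  have h1 := congrArg (fun X => star v ⬝ᵥ (X *ᵥ v)) h
  simp only [sub_mulVec, ← mulVec_mulVec, hv0, mulVec_zero, sub_zero, smul_mulVec,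
    dotProduct_smul] at h1
  rw [dotProduct_mulVec, ← star_mulVec, hv0, star_zero, zero_dotProduct] at h1
  have h2 := (posDef_map_ofReal_iff.2 hZ.2).dotProduct_mulVec_pos hv
  have : (2 * Complex.I) ≠ 0 := by simp
  exact h2.ne ((smul_eq_zero.1 h1.symm).resolve_left this).symm

lemma det_denom_ne_zero (M : Gamma2) {Z : Matrix (Fin 2) (Fin 2) ℂ} (hZ : Z ∈ upperHalf) :
    (denom M Z).det ≠ 0 :=
  (isUnit_det_denom M hZ).ne_zero

lemma act_mem (M : Gamma2) {Z : Matrix (Fin 2) (Fin 2) ℂ} (hZ : Z ∈ upperHalf) :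
    act M Z ∈ upperHalf := by
  have hu := isUnit_det_denom M hZ
  have hc : act M Z * denom M Z = numer M Z := by
    rw [act_eq, mul_assoc, nonsing_inv_mul _ hu, mul_one]
  have huT : IsUnit ((denom M Z)ᵀ).det := by rwa [det_transpose]
  have hsymm : (act M Z).IsSymm := by
    have h := transpose_numer_mul_denom M hZ.1
    rw [← hc, transpose_mul, mul_assoc, ← mul_assoc _ (act M Z)ᵀ,
      ← mul_assoc _ (act M Z)] at h
    rw [mul_assoc, mul_assoc] at h
    have h1 := congrArg (fun X => (denom M Z)ᵀ⁻¹ * X) h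
    simp only [← mul_assoc, nonsing_inv_mul _ huT, one_mul] at h1
    have h2 := congrArg (fun X => X * (denom M Z)⁻¹) h1
    rw [mul_assoc, mul_nonsing_inv _ hu, mul_one, mul_assoc, mul_nonsing_inv _ hu, mul_one] at h2
    exact h2
  refine ⟨hsymm, posDef_map_ofReal_iff.1 ?_⟩
  have h := conjTranspose_denom_mul_numer M Z
  rw [← hc, conjTranspose_mul, mul_assoc, ← mul_sub, ← sub_mul,
    sub_conjTranspose_of_isSymm hsymm, sub_conjTranspose_of_isSymm hZ.1, smul_mul_assoc,
    mul_smul_comm] at h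
  have h' := smul_right_injective _ (show (2 * Complex.I) ≠ 0 by simp) h
  have hpos := posDef_map_ofReal_iff.2 hZ.2
  rw [← h', ← mul_assoc] at hpos
  exact ((isUnit_iff_isUnit_det _).2 hu).posDef_star_left_conjugate_iff.1 hpos

lemma toBlocks_mul (M N : Gamma2) :
    (M * N).1.toBlocks₁₁ = M.1.toBlocks₁₁ * N.1.toBlocks₁₁ + M.1.toBlocks₁₂ * N.1.toBlocks₂₁ ∧
    (M * N).1.toBlocks₁₂ = M.1.toBlocks₁₁ * N.1.toBlocks₁₂ + M.1.toBlocks₁₂ * N.1.toBlocks₂₂ ∧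
    (M * N).1.toBlocks₂₁ = M.1.toBlocks₂₁ * N.1.toBlocks₁₁ + M.1.toBlocks₂₂ * N.1.toBlocks₂₁ ∧
    (M * N).1.toBlocks₂₂ = M.1.toBlocks₂₁ * N.1.toBlocks₁₂ + M.1.toBlocks₂₂ * N.1.toBlocks₂₂ := by
  have h : (M * N).1 = fromBlocks M.1.toBlocks₁₁ M.1.toBlocks₁₂ M.1.toBlocks₂₁ M.1.toBlocks₂₂ *
      fromBlocks N.1.toBlocks₁₁ N.1.toBlocks₁₂ N.1.toBlocks₂₁ N.1.toBlocks₂₂ := by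
    rw [fromBlocks_toBlocks, fromBlocks_toBlocks]; rfl
  rw [h, fromBlocks_multiply]
  exact ⟨rfl, rfl, rfl, rfl⟩

lemma denom_mul (M N : Gamma2) {Z : Matrix (Fin 2) (Fin 2) ℂ} (hZ : Z ∈ upperHalf) :
    denom (M * N) Z = denom M (act N Z) * denom N Z := by
  obtain ⟨-, -, h1, h2⟩ := toBlocks_mul M N
  have hu := isUnit_det_denom N hZ
  rw [denom, h1, h2, denom, add_mul, act_eq, mul_assoc, mul_assoc, nonsing_inv_mul _ hu, mul_one,
    numer, denom]
  simp only [toC_add, toC_mul]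
  noncomm_ring

lemma numer_mul (M N : Gamma2) {Z : Matrix (Fin 2) (Fin 2) ℂ} (hZ : Z ∈ upperHalf) :
    numer (M * N) Z = numer M (act N Z) * denom N Z := by
  obtain ⟨h1, h2, -, -⟩ := toBlocks_mul M N
  have hu := isUnit_det_denom N hZ
  rw [numer, h1, h2, numer, add_mul, act_eq, mul_assoc, mul_assoc, nonsing_inv_mul _ hu, mul_one,
    numer, denom]
  simp only [toC_add, toC_mul]
  noncomm_ring

lemma act_mul (M N : Gamma2) {Z : Matrix (Fin 2) (Fin 2) ℂ} (hZ : Z ∈ upperHalf) :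
    act (M * N) Z = act M (act N Z) := by
  rw [act_eq (M * N), numer_mul M N hZ, denom_mul M N hZ, Matrix.mul_inv_rev, mul_assoc,
    ← mul_assoc (denom N Z), mul_nonsing_inv _ (isUnit_det_denom N hZ), one_mul, act_eq M (act N Z)]

lemma denom_one (Z : Matrix (Fin 2) (Fin 2) ℂ) : denom 1 Z = 1 := by
  have h1 : (1 : Gamma2).1.toBlocks₂₁ = 0 := by
    ext i j; simp [toBlocks₂₁]
  have h2 : (1 : Gamma2).1.toBlocks₂₂ = 1 := by
    ext i j; simp [toBlocks₂₂, one_apply]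
  rw [denom, h1, h2, toC_one]
  simp [toC]

lemma act_one (Z : Matrix (Fin 2) (Fin 2) ℂ) : act 1 Z = Z := by
  have h1 : (1 : Gamma2).1.toBlocks₁₁ = 1 := by
    ext i j; simp [toBlocks₁₁, one_apply]
  have h2 : (1 : Gamma2).1.toBlocks₁₂ = 0 := by
    ext i j; simp [toBlocks₁₂]
  rw [act_eq, denom_one, numer, h1, h2, toC_one]
  simp [toC]

end Action

/-! ### Transformation of theta products -/

/-- `T_𝔫(MZ) = c · det(CZ + D)³ · T_𝔫'(Z)` on `ℍ₂`: the element `M` carries the theta product of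
`n` to that of `n'`, up to the constant `c`. For `n' = n` this is `HasMultiplier`. -/
def Carries (M : Gamma2) (n n' : Finset ThetaChar) (c : ℂ) : Prop :=
  ∀ Z ∈ upperHalf, thetaProd n (act M Z) = c * (denom M Z).det ^ 3 * thetaProd n' Z

namespace Carries

variable {M N : Gamma2} {n n' n'' : Finset ThetaChar} {c d : ℂ}

lemma mul (hM : Carries M n n' c) (hN : Carries N n' n'' d) :
    Carries (M * N) n n'' (c * d) := by
  intro Z hZ
  rw [act_mul M N hZ, hM _ (act_mem N hZ), hN Z hZ, denom_mul M N hZ, det_mul]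
  ring

lemma inv (hM : Carries M n n' c) (hc : c ≠ 0) : Carries M⁻¹ n' n c⁻¹ := by
  intro Z hZ
  have h1 := hM _ (act_mem M⁻¹ hZ)
  have h2 := denom_mul M M⁻¹ hZ
  rw [← act_mul M M⁻¹ hZ, mul_inv_cancel, act_one] at h1
  rw [mul_inv_cancel, denom_one] at h2
  have h3 := congrArg det h2
  rw [det_one, det_mul] at h3
  have h4 : (denom M (act M⁻¹ Z)).det ^ 3 * (denom M⁻¹ Z).det ^ 3 = 1 := by
    rw [← mul_pow, ← h3, one_pow]
  rw [h1]
  field_simp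
  linear_combination -(thetaProd n' (act M⁻¹ Z)) * h4

end Carries

lemma carries_one (n : Finset ThetaChar) : Carries 1 n n 1 := by
  intro Z _
  simp [act_one, denom_one]

/-! ### Absolute convergence of the theta series -/

/-- The summand of the theta series `theta m Z` at `g`. -/
noncomputable def thetaTerm (m : ThetaChar) (Z : Matrix (Fin 2) (Fin 2) ℂ) (g : Fin 2 → ℤ) : ℂ :=
  Complex.exp (Real.pi * Complex.I *
    (shifted m.1 g ⬝ᵥ (Z *ᵥ shifted m.1 g) +
      (fun i => ((m.2 i).val : ℂ)) ⬝ᵥ shifted m.1 g))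

lemma theta_eq_tsum (m : ThetaChar) (Z : Matrix (Fin 2) (Fin 2) ℂ) :
    theta m Z = ∑' g, thetaTerm m Z g := rfl

/-- The constant is `det Y / tr Y`, since `tr Y · Y[x] - det Y · |x|² = |Y x|²` by
Cayley–Hamilton. -/
lemma exists_mul_sq_le_of_posDef {Y : Matrix (Fin 2) (Fin 2) ℝ} (hY : Y.PosDef) :
    ∃ δ > 0, ∀ x y : ℝ,
      δ * (x ^ 2 + y ^ 2) ≤ Y 0 0 * x ^ 2 + (Y 0 1 + Y 1 0) * (x * y) + Y 1 1 * y ^ 2 := by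
  have hs : Y 1 0 = Y 0 1 := by simpa using congrFun (congrFun hY.1 0) 1
  have hdet := hY.det_pos
  rw [det_fin_two, hs] at hdet
  have h0 : 0 < Y 0 0 := hY.diag_pos
  have h1 : 0 < Y 1 1 := hY.diag_pos
  refine ⟨(Y 0 0 * Y 1 1 - Y 0 1 * Y 0 1) / (Y 0 0 + Y 1 1), by positivity, fun x y => ?_⟩
  rw [div_mul_eq_mul_div, div_le_iff₀ (by positivity), hs]
  nlinarith [sq_nonneg (Y 0 0 * x + Y 0 1 * y), sq_nonneg (Y 0 1 * x + Y 1 1 * y)]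

lemma summable_exp_neg_sq_int {δ : ℝ} (hδ : 0 < δ) (t : ℝ) :
    Summable fun n : ℤ => Real.exp (-Real.pi * (δ * (n + t) ^ 2)) := by
  have h := (summable_jacobiTheta₂_term_iff (Complex.I * (δ * t : ℝ)) (Complex.I * (δ : ℝ))).2
    (by simpa using hδ)
  have h' := h.norm.mul_left (Real.exp (-Real.pi * (δ * t ^ 2)))
  refine h'.congr fun n => ?_
  rw [norm_jacobiTheta₂_term, ← Real.exp_add]
  congr 1
  simp
  ring

lemma summable_exp_neg_sq {δ : ℝ} (hδ : 0 < δ) (s t : ℝ) :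
    Summable fun g : Fin 2 → ℤ =>
      Real.exp (-Real.pi * (δ * ((g 0 + s) ^ 2 + (g 1 + t) ^ 2))) := by
  have h := (summable_exp_neg_sq_int hδ s).mul_of_nonneg (summable_exp_neg_sq_int hδ t)
    (fun _ => (Real.exp_pos _).le) (fun _ => (Real.exp_pos _).le)
  refine ((finTwoArrowEquiv ℤ).summable_iff.2 h).congr fun g => ?_
  simp only [Function.comp, ← Real.exp_add]
  congr 1
  change -Real.pi * (δ * (g 0 + s) ^ 2) + -Real.pi * (δ * (g 1 + t) ^ 2) = _
  ring

lemma norm_thetaTerm (m : ThetaChar) (Z : Matrix (Fin 2) (Fin 2) ℂ) (g : Fin 2 → ℤ) :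
    ‖thetaTerm m Z g‖ = Real.exp (-Real.pi * ((Z 0 0).im * (g 0 + (m.1 0).val / 2) ^ 2 +
      ((Z 0 1).im + (Z 1 0).im) * ((g 0 + (m.1 0).val / 2) * (g 1 + (m.1 1).val / 2)) +
      (Z 1 1).im * (g 1 + (m.1 1).val / 2) ^ 2)) := by
  rw [thetaTerm, Complex.norm_exp]
  congr 1
  have hx : ∀ i, shifted m.1 g i = ((g i + (m.1 i).val / 2 : ℝ) : ℂ) := fun i => by
    simp [shifted, -ZMod.natCast_val]
  have hb : ∀ i, ((m.2 i).val : ℂ) = (((m.2 i).val : ℝ) : ℂ) := fun i => by simp [-ZMod.natCast_val]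
  simp only [dotProduct, mulVec, Fin.sum_univ_two, hx, hb]
  simp only [Complex.mul_re, Complex.mul_im, Complex.add_re, Complex.add_im, Complex.ofReal_re,
    Complex.ofReal_im, Complex.I_re, Complex.I_im]
  ring

lemma norm_thetaTerm_le (m : ThetaChar) {Z : Matrix (Fin 2) (Fin 2) ℂ} {δ : ℝ}
    (h : ∀ x y : ℝ, δ * (x ^ 2 + y ^ 2) ≤
      (Z 0 0).im * x ^ 2 + ((Z 0 1).im + (Z 1 0).im) * (x * y) + (Z 1 1).im * y ^ 2)
    (g : Fin 2 → ℤ) :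
    ‖thetaTerm m Z g‖ ≤ Real.exp (-Real.pi *
      (δ * ((g 0 + (m.1 0).val / 2) ^ 2 + (g 1 + (m.1 1).val / 2) ^ 2))) := by
  rw [norm_thetaTerm]
  gcongr Real.exp ?_
  exact mul_le_mul_of_nonpos_left (h _ _) (by simpa using Real.pi_pos.le)

lemma summable_thetaTerm (m : ThetaChar) {Z : Matrix (Fin 2) (Fin 2) ℂ} (hZ : Z ∈ upperHalf) :
    Summable (thetaTerm m Z) := by
  obtain ⟨δ, hδ, h⟩ := exists_mul_sq_le_of_posDef hZ.2
  exact .of_norm_bounded (summable_exp_neg_sq hδ _ _) (norm_thetaTerm_le m h)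

/-! ### Theta functions under translations, unimodular substitutions and partial inversion -/

lemma exp_pi_mul_I_mul_two_mul_int (k : ℤ) :
    Complex.exp (Real.pi * Complex.I * (2 * k)) = 1 := by
  rw [← Complex.exp_int_mul_two_pi_mul_I k]
  congr 1
  ring

lemma theta_translate (m : ThetaChar) (Z : Matrix (Fin 2) (Fin 2) ℂ) (p q r : ℤ) :
    theta m (Z + toC !![2 * p, 2 * q; 2 * q, 2 * r]) =
      Complex.exp (Real.pi * Complex.I * (((p * (m.1 0).val ^ 2 +
        2 * q * ((m.1 0).val * (m.1 1).val) + r * (m.1 1).val ^ 2 : ℤ) : ℂ) / 2)) *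
      theta m Z := by
  rw [theta_eq_tsum, theta_eq_tsum, ← tsum_mul_left]
  refine tsum_congr fun g => ?_
  rw [thetaTerm, thetaTerm, ← mul_one (Complex.exp _ * _), ← exp_pi_mul_I_mul_two_mul_int
    (p * (g 0 ^ 2 + g 0 * (m.1 0).val) + q * (2 * g 0 * g 1 + g 0 * (m.1 1).val +
      g 1 * (m.1 0).val) + r * (g 1 ^ 2 + g 1 * (m.1 1).val)), ← Complex.exp_add,
    ← Complex.exp_add]
  congr 1
  simp [toC, shifted, dotProduct, mulVec, Fin.sum_univ_two]
  ring

/-- The involution of the characteristics belonging to the exchange of the two variables. -/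
def swapVars (m : ThetaChar) : ThetaChar := (![m.1 1, m.1 0], ![m.2 1, m.2 0])

lemma theta_swap (m : ThetaChar) (Z : Matrix (Fin 2) (Fin 2) ℂ) :
    theta m !![Z 1 1, Z 1 0; Z 0 1, Z 0 0] = theta (swapVars m) Z := by
  rw [theta_eq_tsum, theta_eq_tsum, ← ((Equiv.swap (0 : Fin 2) 1).arrowCongr
    (Equiv.refl ℤ)).tsum_eq]
  refine tsum_congr fun g => ?_
  rw [thetaTerm, thetaTerm]
  congr 1
  simp [swapVars, shifted, dotProduct, mulVec, Fin.sum_univ_two, Equiv.arrowCongr]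
  ring

/-- The one-variable inversion formula: the functional equation of the Jacobi theta function, in
terms of characteristics. -/
lemma tsum_exp_inversion {τ : ℂ} (hτ : 0 < τ.im) (w a b : ℂ) (a' b' : ℤ) (ha : a = a')
    (hb : b = b') :
    ∑' n : ℤ, Complex.exp (Real.pi * Complex.I *
        (τ * (n + a / 2) ^ 2 + 2 * (n + a / 2) * (w + b / 2))) =
      1 / (-Complex.I * τ) ^ (1 / 2 : ℂ) * Complex.exp (Real.pi * Complex.I * (a * b / 2)) *
      ∑' n : ℤ, Complex.exp (Real.pi * Complex.I * (-1 / τ * (n + b / 2) ^ 2 +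
        2 * (w / τ) * (n + b / 2) - w ^ 2 / τ + a * (n + b / 2))) := by
  have hτ0 : τ ≠ 0 := by rintro rfl; simp at hτ
  have key := jacobiTheta₂_functional_equation (w + b / 2 + a * τ / 2) τ
  have hl : ∑' n : ℤ, Complex.exp (Real.pi * Complex.I *
        (τ * (n + a / 2) ^ 2 + 2 * (n + a / 2) * (w + b / 2))) =
      Complex.exp (Real.pi * Complex.I * (τ * a ^ 2 / 4 + a * (w + b / 2))) *
        jacobiTheta₂ (w + b / 2 + a * τ / 2) τ := by
    rw [jacobiTheta₂, ← tsum_mul_left]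
    refine tsum_congr fun n => ?_
    rw [jacobiTheta₂_term, ← Complex.exp_add]
    congr 1
    ring
  rw [hl, key, jacobiTheta₂, ← (Equiv.addRight b').tsum_eq, ← tsum_mul_left, ← tsum_mul_left,
    ← tsum_mul_left]
  refine tsum_congr fun n => ?_
  have e1 : ∀ x c d f : ℂ, Complex.exp x * (c * Complex.exp d * Complex.exp f) =
      c * Complex.exp (x + d + f) := fun x c d f => by
    rw [Complex.exp_add, Complex.exp_add]; ring
  rw [jacobiTheta₂_term, e1, mul_assoc (1 / _), ← Complex.exp_add]
  congr 2
  subst ha hb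
  simp only [Equiv.coe_addRight, Int.cast_add]
  field_simp
  ring

/-- The involution of the characteristics belonging to the inversion in the first variable. -/
def invertFirst (m : ThetaChar) : ThetaChar := (![m.2 0, m.1 1], ![m.1 0, m.2 1])

lemma theta_eq_iterated (m : ThetaChar) {Z : Matrix (Fin 2) (Fin 2) ℂ} (hZ : Z ∈ upperHalf) :
    theta m Z = ∑' k : ℤ, ∑' n : ℤ, thetaTerm m Z ![n, k] := by
  rw [theta_eq_tsum, ← (finTwoArrowEquiv ℤ).symm.tsum_eq, ← (Equiv.prodComm ℤ ℤ).tsum_eq]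
  exact ((Equiv.prodComm ℤ ℤ).summable_iff.2
    ((finTwoArrowEquiv ℤ).symm.summable_iff.2 (summable_thetaTerm m hZ))).tsum_prod

/-- Inversion in the first variable exchanges `a₁` and `b₁`: the one-variable formula is applied to
the inner sums of the theta series, over the first coordinate. -/
lemma theta_inversion (m : ThetaChar) {Z : Matrix (Fin 2) (Fin 2) ℂ} (hZ : Z ∈ upperHalf)
    (hZ' : !![-1 / Z 0 0, Z 0 1 / Z 0 0; Z 0 1 / Z 0 0, Z 1 1 - Z 0 1 ^ 2 / Z 0 0] ∈ upperHalf) :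
    theta m Z = 1 / (-Complex.I * Z 0 0) ^ (1 / 2 : ℂ) *
      Complex.exp (Real.pi * Complex.I * ((m.1 0).val * (m.2 0).val / 2)) *
      theta (invertFirst m)
        !![-1 / Z 0 0, Z 0 1 / Z 0 0; Z 0 1 / Z 0 0, Z 1 1 - Z 0 1 ^ 2 / Z 0 0] := by
  have hτ : 0 < (Z 0 0).im := hZ.2.diag_pos
  have hs : Z 1 0 = Z 0 1 := hZ.1.apply 0 1
  rw [theta_eq_iterated m hZ, theta_eq_iterated _ hZ', ← tsum_mul_left]
  refine tsum_congr fun k => ?_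
  set x : ℂ := k + (m.1 1).val / 2 with hx
  have h := tsum_exp_inversion hτ (Z 0 1 * x) (m.1 0).val (m.2 0).val ((m.1 0).val : ℤ)
    ((m.2 0).val : ℤ) (by simp) (by simp)
  have h' := congrArg (fun y => Complex.exp (Real.pi * Complex.I *
    (Z 1 1 * x ^ 2 + (m.2 1).val * x)) * y) h
  beta_reduce at h'
  rw [mul_left_comm, ← tsum_mul_left, ← tsum_mul_left] at h'
  refine Eq.trans (tsum_congr fun n => ?_) (h'.trans ?_)
  · rw [thetaTerm, ← Complex.exp_add]
    congr 1
    simp [shifted, dotProduct, mulVec, Fin.sum_univ_two, hs, hx]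
    ring
  · congr 1
    refine tsum_congr fun n => ?_
    rw [thetaTerm, ← Complex.exp_add]
    congr 1
    simp [invertFirst, shifted, dotProduct, mulVec, Fin.sum_univ_two, hx]
    ring

lemma shifted_reindex (U W : Matrix (Fin 2) (Fin 2) ℤ) (hUW : (1 + (W + W)) * U = 1)
    (a : Fin 2 → ZMod 2) (g : Fin 2 → ℤ) :
    (toC U)ᵀ *ᵥ shifted a ((1 + (W + W))ᵀ *ᵥ g + Wᵀ *ᵥ fun i => ((a i).val : ℤ)) =
      shifted a g := by
  have h1 : shifted a ((1 + (W + W))ᵀ *ᵥ g + Wᵀ *ᵥ fun i => ((a i).val : ℤ)) =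
      (toC (1 + (W + W)))ᵀ *ᵥ shifted a g := by
    ext i
    fin_cases i <;>
    simp [shifted, toC, mulVec, dotProduct, Fin.sum_univ_two, one_apply] <;> ring
  rw [h1, mulVec_mulVec, ← transpose_mul, ← toC_mul, hUW, toC_one, transpose_one, one_mulVec]

/-- Here `U⁻¹ = 1 + 2W`; the lattice is reindexed by `g ↦ ᵗU⁻¹ g + ᵗW a`, which takes
`ᵗU (g + a/2)` to `g + a/2`. -/
lemma theta_unimodular (m : ThetaChar) (Z : Matrix (Fin 2) (Fin 2) ℂ)
    (U W : Matrix (Fin 2) (Fin 2) ℤ) (hUW : (1 + (W + W)) * U = 1) :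
    theta m (toC U * Z * (toC U)ᵀ) =
      Complex.exp (Real.pi * Complex.I *
        ((∑ i, ∑ j, W i j * ((m.1 i).val * (m.2 j).val) : ℤ) : ℂ)) *
      theta m Z := by
  have hWU : U * (1 + (W + W)) = 1 := mul_eq_one_comm.1 hUW
  let t : Fin 2 → ℤ := Wᵀ *ᵥ fun i => ((m.1 i).val : ℤ)
  let e : (Fin 2 → ℤ) ≃ (Fin 2 → ℤ) :=
    { toFun := fun g => (1 + (W + W))ᵀ *ᵥ g + t
      invFun := fun g => Uᵀ *ᵥ (g - t)
      left_inv := fun g => by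
        simp only [add_sub_cancel_right, mulVec_mulVec]
        rw [← transpose_mul, hUW, transpose_one, one_mulVec]
      right_inv := fun g => by
        simp only [mulVec_mulVec]
        rw [← transpose_mul, hWU, transpose_one, one_mulVec, sub_add_cancel] }
  rw [theta_eq_tsum, theta_eq_tsum, ← tsum_mul_left, ← e.tsum_eq]
  refine tsum_congr fun g => ?_
  have h1 : (toC U)ᵀ *ᵥ shifted m.1 (e g) = shifted m.1 g := shifted_reindex U W hUW m.1 g
  have h2 : shifted m.1 (e g) = (toC (1 + (W + W)))ᵀ *ᵥ shifted m.1 g := by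
    rw [← h1, mulVec_mulVec, ← transpose_mul, ← toC_mul, hWU, toC_one, transpose_one, one_mulVec]
  have h3 : shifted m.1 (e g) ⬝ᵥ ((toC U * Z * (toC U)ᵀ) *ᵥ shifted m.1 (e g)) =
      shifted m.1 g ⬝ᵥ (Z *ᵥ shifted m.1 g) := by
    rw [← mulVec_mulVec, h1, ← mulVec_mulVec, dotProduct_mulVec, ← mulVec_transpose, h1]
  rw [thetaTerm, h3, h2, thetaTerm, ← mul_one (Complex.exp _ * _), ← exp_pi_mul_I_mul_two_mul_int
    (∑ i, ∑ j, W i j * (g i * (m.2 j).val)), ← Complex.exp_add, ← Complex.exp_add]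
  congr 1
  simp [shifted, toC, mulVec, dotProduct, Fin.sum_univ_two, one_apply]
  ring

/-! ### Generating elements and their multipliers -/

/-- The translation matrix with `S = (p q; q r)`. -/
def upper (p q r : ℤ) : Gamma2 :=
  ⟨fromBlocks 1 !![p, q; q, r] 0 1, by
    rw [SymplecticGroup.fromBlocks_mem_iff]
    simp [← ext_iff, Fin.forall_fin_two]⟩

/-- The transposed translation matrix with lower left block `(p q; q r)`. -/
def lower (p q r : ℤ) : Gamma2 :=
  ⟨fromBlocks 1 0 !![p, q; q, r] 1, by
    rw [SymplecticGroup.fromBlocks_mem_iff]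
    simp [← ext_iff, Fin.forall_fin_two]⟩

/-- The block diagonal embedding `U ↦ (U 0; 0 ᵗU⁻¹)`, for a unit `U` with inverse `V`. -/
def levi (U V : Matrix (Fin 2) (Fin 2) ℤ) (h : V * U = 1) : Gamma2 :=
  ⟨fromBlocks U 0 0 Vᵀ, by
    rw [SymplecticGroup.fromBlocks_mem_iff]
    simp [← transpose_mul, h]⟩

/-- The element acting on `ℍ₂` by inversion in the first variable. -/
def partialInversion : Gamma2 :=
  ⟨fromBlocks !![0, 0; 0, 1] !![-1, 0; 0, 0] !![1, 0; 0, 0] !![0, 0; 0, 1], by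
    rw [SymplecticGroup.fromBlocks_mem_iff]
    decide⟩

/-- The element acting on `ℍ₂` by exchange of the two variables. -/
def swapElt : Gamma2 := levi !![0, 1; 1, 0] !![0, 1; 1, 0] (by decide)

lemma act_upper (p q r : ℤ) (Z : Matrix (Fin 2) (Fin 2) ℂ) :
    act (upper p q r) Z = Z + toC !![p, q; q, r] ∧ (denom (upper p q r) Z).det = 1 := by
  have h : denom (upper p q r) Z = 1 := by
    simp [denom, upper, toC_one]
    simp [toC]
  refine ⟨?_, by rw [h, det_one]⟩
  rw [act, h]
  simp [upper, toC_one]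

lemma act_levi (U V : Matrix (Fin 2) (Fin 2) ℤ) (h : V * U = 1) (Z : Matrix (Fin 2) (Fin 2) ℂ) :
    act (levi U V h) Z = toC U * Z * (toC U)ᵀ ∧ (denom (levi U V h) Z).det = (V.det : ℂ) := by
  have hd : denom (levi U V h) Z = (toC V)ᵀ := by
    simp [denom, levi, toC_transpose]
    simp [toC]
  have hi : ((toC V)ᵀ)⁻¹ = (toC U)ᵀ := by
    refine inv_eq_left_inv ?_
    rw [← transpose_mul, ← toC_mul, h, toC_one, transpose_one]
  have hz : toC 0 = 0 := by simp [toC]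
  refine ⟨?_, ?_⟩
  · rw [act, hd, hi]
    simp [levi, hz]
  · rw [hd, det_transpose]
    simp [toC, det_fin_two]

lemma act_swapElt {Z : Matrix (Fin 2) (Fin 2) ℂ} :
    act swapElt Z = !![Z 1 1, Z 1 0; Z 0 1, Z 0 0] ∧ (denom swapElt Z).det = -1 := by
  obtain ⟨h1, h2⟩ := act_levi !![0, 1; 1, 0] !![0, 1; 1, 0] (by decide) Z
  refine ⟨h1.trans ?_, h2.trans ?_⟩
  · ext i j
    fin_cases i <;> fin_cases j <;> simp [toC, mul_apply, Fin.sum_univ_two]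
  · simp [det_fin_two]

lemma act_partialInversion {Z : Matrix (Fin 2) (Fin 2) ℂ} (hZ : Z ∈ upperHalf) :
    act partialInversion Z =
      !![-1 / Z 0 0, Z 0 1 / Z 0 0; Z 0 1 / Z 0 0, Z 1 1 - Z 0 1 ^ 2 / Z 0 0] ∧
    (denom partialInversion Z).det = Z 0 0 := by
  have hτ : 0 < (Z 0 0).im := hZ.2.diag_pos
  have hτ0 : Z 0 0 ≠ 0 := fun h => by simp [h] at hτ
  have hs : Z 1 0 = Z 0 1 := hZ.1.apply 0 1
  have hd : denom partialInversion Z = !![Z 0 0, Z 0 1; 0, 1] := by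
    ext i j
    fin_cases i <;> fin_cases j <;>
      simp [denom, partialInversion, toC, mul_apply, Fin.sum_univ_two]
  have hi : (denom partialInversion Z)⁻¹ = !![1 / Z 0 0, -Z 0 1 / Z 0 0; 0, 1] := by
    refine inv_eq_left_inv ?_
    rw [hd]
    ext i j
    fin_cases i <;> fin_cases j <;> simp [mul_apply, Fin.sum_univ_two, hτ0]
    field_simp
    ring
  refine ⟨?_, by rw [hd]; simp [det_fin_two]⟩
  rw [act, hi]
  ext i j
  fin_cases i <;> fin_cases j <;>
    simp [partialInversion, toC, mul_apply, Fin.sum_univ_two, hs]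
  all_goals ring

/-- The sextuple of the even characteristics `(a, b)` with `b ≠ 0`. -/
def dualSextuple : Finset ThetaChar :=
  {(![0, 0], ![1, 0]), (![0, 1], ![1, 0]), (![0, 0], ![0, 1]), (![1, 0], ![0, 1]),
    (![0, 0], ![1, 1]), (![1, 1], ![1, 1])}

lemma exp_pi_mul_I_mul_int (k : ℤ) :
    Complex.exp (Real.pi * Complex.I * k) = (-1) ^ k := by
  rw [mul_comm, Complex.exp_int_mul, Complex.exp_pi_mul_I]

lemma carries_upper (n : Finset ThetaChar) (p q r e : ℤ)
    (h : ∑ m ∈ n, (p * (m.1 0).val ^ 2 + 2 * q * ((m.1 0).val * (m.1 1).val) +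
      r * (m.1 1).val ^ 2 : ℤ) = 2 * e) :
    Carries (upper (2 * p) (2 * q) (2 * r)) n n ((-1) ^ e) := by
  intro Z _
  obtain ⟨h1, h2⟩ := act_upper (2 * p) (2 * q) (2 * r) Z
  rw [h1, h2, thetaProd, Finset.prod_congr rfl fun m _ => theta_translate m Z p q r,
    Finset.prod_mul_distrib, ← Complex.exp_sum, ← Finset.mul_sum, ← Finset.sum_div,
    ← Int.cast_sum, h, ← exp_pi_mul_I_mul_int, thetaProd]
  simp

lemma carries_upper_standardSextuple (p q r : ℤ) :
    Carries (upper (2 * p) (2 * q) (2 * r)) standardSextuple standardSextuple 1 := by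
  have h := carries_upper standardSextuple p q r (2 * (p + q + r)) (by
    simp only [Finset.sum_add_distrib, ← Finset.mul_sum]
    have h1 : ∑ m ∈ standardSextuple, ((m.1 0).val : ℤ) ^ 2 = 4 := by decide +kernel
    have h2 : ∑ m ∈ standardSextuple, ((m.1 0).val * (m.1 1).val : ℤ) = 2 := by decide +kernel
    have h3 : ∑ m ∈ standardSextuple, ((m.1 1).val : ℤ) ^ 2 = 4 := by decide +kernel
    rw [h1, h2, h3]
    ring)
  rwa [(even_two_mul _).neg_one_zpow] at h

lemma carries_upper_dualSextuple (p q r : ℤ) :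
    Carries (upper (2 * p) (2 * q) (2 * r)) dualSextuple dualSextuple ((-1) ^ (p + q + r)) := by
  refine carries_upper dualSextuple p q r (p + q + r) ?_
  simp only [Finset.sum_add_distrib, ← Finset.mul_sum]
  have h1 : ∑ m ∈ dualSextuple, ((m.1 0).val : ℤ) ^ 2 = 2 := by decide +kernel
  have h2 : ∑ m ∈ dualSextuple, ((m.1 0).val * (m.1 1).val : ℤ) = 1 := by decide +kernel
  have h3 : ∑ m ∈ dualSextuple, ((m.1 1).val : ℤ) ^ 2 = 2 := by decide +kernel
  rw [h1, h2, h3]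
  ring

/-- The product of the six phases is `(-1) ^ tr W`, which equals `det U = det (1 + 2W)`
because `det (1 + 2W) ≡ 1 + 2 tr W mod 4`. -/
lemma carries_levi (U W : Matrix (Fin 2) (Fin 2) ℤ) (hUW : (1 + (W + W)) * U = 1) :
    Carries (levi U _ hUW) standardSextuple standardSextuple 1 := by
  intro Z _
  obtain ⟨h1, h2⟩ := act_levi U _ hUW Z
  have hsum : ∑ m ∈ standardSextuple, (∑ i, ∑ j, W i j * ((m.1 i).val * (m.2 j).val) : ℤ) =
      W 0 0 + W 1 1 + 2 * (W 0 1 + W 1 0) := by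
    simp only [Fin.sum_univ_two, Finset.sum_add_distrib, ← Finset.mul_sum]
    have h1 : ∑ m ∈ standardSextuple, ((m.1 0).val * (m.2 0).val : ℤ) = 1 := by decide +kernel
    have h2 : ∑ m ∈ standardSextuple, ((m.1 0).val * (m.2 1).val : ℤ) = 2 := by decide +kernel
    have h3 : ∑ m ∈ standardSextuple, ((m.1 1).val * (m.2 0).val : ℤ) = 2 := by decide +kernel
    have h4 : ∑ m ∈ standardSextuple, ((m.1 1).val * (m.2 1).val : ℤ) = 1 := by decide +kernel
    rw [h1, h2, h3, h4]
    ring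
  have hdet : (1 + (W + W)).det * U.det = 1 := by rw [← det_mul, hUW, det_one]
  have hdet2 : (1 + (W + W)).det =
      1 + 2 * (W 0 0 + W 1 1) + 4 * (W 0 0 * W 1 1 - W 0 1 * W 1 0) := by
    rw [det_fin_two]
    simp
    ring
  have hsign : ((-1) ^ (W 0 0 + W 1 1 + 2 * (W 0 1 + W 1 0)) : ℂ) =
      1 * (((1 + (W + W)).det : ℤ) : ℂ) ^ 3 := by
    rcases Int.eq_one_or_neg_one_of_mul_eq_one hdet with hd | hd
    · rw [hd, Even.neg_one_zpow]
      · simp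
      · rw [Int.even_iff]; omega
    · rw [hd, Odd.neg_one_zpow]
      · norm_num
      · rw [Int.odd_iff]; omega
  rw [h1, h2, thetaProd, Finset.prod_congr rfl fun m _ => theta_unimodular m Z U W hUW,
    Finset.prod_mul_distrib, ← Complex.exp_sum, ← Finset.mul_sum, ← Int.cast_sum, hsum,
    exp_pi_mul_I_mul_int, hsign, thetaProd]

lemma swapVars_involutive : Function.Involutive swapVars := by
  unfold Function.Involutive; decide +kernel

lemma invertFirst_involutive : Function.Involutive invertFirst := by
  unfold Function.Involutive; decide +kernel

lemma carries_swapElt (n : Finset ThetaChar) :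
    Carries swapElt n (n.image swapVars) (-1) := by
  intro Z _
  obtain ⟨h1, h2⟩ := act_swapElt (Z := Z)
  rw [h1, h2, thetaProd, thetaProd,
    Finset.prod_image (swapVars_involutive.injective.injOn),
    Finset.prod_congr rfl fun m _ => theta_swap m Z]
  norm_num

/-- The square roots of the inversion formula combine to `(-iτ)³` in a product of six theta
functions. -/
lemma exists_carries_partialInversion (n : Finset ThetaChar) (hn : n.card = 6) :
    ∃ c ≠ 0, Carries partialInversion n (n.image invertFirst) c := by
  let k : ThetaChar → ℂ := fun m =>
    Complex.exp (Real.pi * Complex.I * ((m.1 0).val * (m.2 0).val / 2))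
  have hk : ∀ m, k m ≠ 0 := fun m => Complex.exp_ne_zero _
  refine ⟨(-Complex.I) ^ 3 * (∏ m ∈ n, k (invertFirst m))⁻¹,
    mul_ne_zero (by simp) (inv_ne_zero (Finset.prod_ne_zero_iff.2 fun m _ => hk _)), ?_⟩
  intro Z hZ
  obtain ⟨h1, h2⟩ := act_partialInversion hZ
  have hZ' := act_mem partialInversion hZ
  have hτ : 0 < (Z 0 0).im := hZ.2.diag_pos
  have hτ0 : Z 0 0 ≠ 0 := fun h => by simp [h] at hτ
  have hm : ∀ m, theta m (act partialInversion Z) =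
      (-Complex.I * Z 0 0) ^ (1 / 2 : ℂ) * ((k (invertFirst m))⁻¹ * theta (invertFirst m) Z) := by
    intro m
    rw [theta_inversion (invertFirst m) hZ (h1 ▸ hZ'), invertFirst_involutive m, h1]
    have : (-Complex.I * Z 0 0) ^ (1 / 2 : ℂ) ≠ 0 := by
      rw [Complex.cpow_ne_zero_iff]; left; simp [hτ0]
    have := hk (invertFirst m)
    simp only [k] at this ⊢
    field_simp
  have hroot : ((-Complex.I * Z 0 0) ^ (1 / 2 : ℂ)) ^ 6 = (-Complex.I * Z 0 0) ^ 3 := by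
    rw [← Complex.cpow_nat_mul]
    norm_num
  rw [h2, thetaProd, thetaProd, Finset.prod_image (invertFirst_involutive.injective.injOn),
    Finset.prod_congr rfl fun m _ => hm m, Finset.prod_mul_distrib, Finset.prod_mul_distrib,
    Finset.prod_const, hn, hroot, Finset.prod_inv_distrib, mul_pow]
  ring

/-- The element `(0 -1; 1 0)`, acting on `ℍ₂` by `Z ↦ -Z⁻¹`. -/
def inversion : Gamma2 := SymplecticGroup.symJ (Fin 2) ℤ

lemma inversion_eq : inversion = partialInversion * swapElt * partialInversion * swapElt := by
  apply Subtype.ext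
  decide +kernel

lemma exists_carries_inversion : ∃ c ≠ 0, Carries inversion dualSextuple standardSextuple c := by
  obtain ⟨c, hc, h⟩ := exists_carries_partialInversion dualSextuple (by decide +kernel)
  have h1 := h.mul (carries_swapElt _)
  obtain ⟨d, hd, h'⟩ := exists_carries_partialInversion
    ((dualSextuple.image invertFirst).image swapVars) (by decide +kernel)
  have h2 := (h1.mul h').mul (carries_swapElt _)
  rw [← inversion_eq, show ((((dualSextuple.image invertFirst).image swapVars).image
    invertFirst).image swapVars) = standardSextuple by decide +kernel] at h2
  exact ⟨_, by simp [hc, hd], h2⟩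

lemma lower_eq_conj (p q r : ℤ) :
    lower p q r = inversion⁻¹ * upper (-p) (-q) (-r) * inversion := by
  rw [mul_assoc, eq_inv_mul_iff_mul_eq]
  apply Subtype.ext
  change J (Fin 2) ℤ * fromBlocks 1 0 !![p, q; q, r] 1 =
    fromBlocks 1 !![-p, -q; -q, -r] 0 1 * J (Fin 2) ℤ
  rw [J, fromBlocks_multiply, fromBlocks_multiply]
  simp

lemma carries_lower (p q r : ℤ) :
    Carries (lower (2 * p) (2 * q) (2 * r)) standardSextuple standardSextuple
      ((-1) ^ (p + q + r)) := by
  obtain ⟨c, hc, h⟩ := exists_carries_inversion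
  have h1 := ((h.inv hc).mul (carries_upper_dualSextuple (-p) (-q) (-r))).mul h
  rw [mul_neg, mul_neg, mul_neg, ← lower_eq_conj] at h1
  have h2 : ((-1 : ℂ) ^ (-p + -q + -r)) = (-1) ^ (p + q + r) := by
    rw [show -p + -q + -r = -(p + q + r) by ring, _root_.zpow_neg, ← _root_.inv_zpow]
    norm_num
  rwa [h2, mul_right_comm, inv_mul_cancel₀ hc, one_mul] at h1

/-! ### Non-vanishing of the theta product -/

/-- A line in the space of symmetric matrices; on the strip `|Im w| < 1/2` it stays in `ℍ₂`. -/
def line (w : ℂ) : Matrix (Fin 2) (Fin 2) ℂ := !![Complex.I, w; w, Complex.I]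

lemma line_bound {v : ℝ} (hv : |v| < 1 / 2) (x y : ℝ) :
    1 / 2 * (x ^ 2 + y ^ 2) ≤ x ^ 2 + (v + v) * (x * y) + y ^ 2 := by
  obtain ⟨h1, h2⟩ := abs_lt.1 hv
  nlinarith [mul_nonneg (by linarith : 0 ≤ 1 / 2 + v) (sq_nonneg (x + y)),
    mul_nonneg (by linarith : 0 ≤ 1 / 2 - v) (sq_nonneg (x - y))]

lemma line_mem {w : ℂ} (hw : |w.im| < 1 / 2) : line w ∈ upperHalf := by
  refine ⟨?_, .of_dotProduct_mulVec_pos ?_ fun x hx => ?_⟩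
  · ext i j; fin_cases i <;> fin_cases j <;> simp [line]
  · ext i j; fin_cases i <;> fin_cases j <;> simp [line]
  · have h := line_bound hw (x 0) (x 1)
    have hpos : 0 < x 0 ^ 2 + x 1 ^ 2 := by
      by_contra h0
      refine hx (funext fun i => ?_)
      have h1 : x 0 = 0 := by nlinarith [sq_nonneg (x 0), sq_nonneg (x 1)]
      have h2 : x 1 = 0 := by nlinarith [sq_nonneg (x 0), sq_nonneg (x 1)]
      fin_cases i <;> simp [h1, h2]
    simp [line, dotProduct, mulVec, Fin.sum_univ_two]
    nlinarith

lemma differentiableOn_theta_line (m : ThetaChar) :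
    DifferentiableOn ℂ (fun w => theta m (line w)) {w : ℂ | |w.im| < 1 / 2} := by
  refine Complex.differentiableOn_tsum_of_summable_norm (F := fun g w => thetaTerm m (line w) g)
    (summable_exp_neg_sq (show (0 : ℝ) < 1 / 2 by norm_num) ((m.1 0).val / 2) ((m.1 1).val / 2))
    (fun g => ?_) (isOpen_lt (by fun_prop) (by fun_prop)) (fun g w hw => ?_)
  · simp only [thetaTerm, line, dotProduct, mulVec, Fin.sum_univ_two]
    simp
    fun_prop
  · refine norm_thetaTerm_le m (fun x y => ?_) g
    simpa [line] using line_bound hw x y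

/-- At `w = 0` for `b = 0`, and at `w = 1` for `b = (a₂, a₁)`, all terms of the theta series have
the same phase, so they cannot cancel. -/
lemma theta_line_ne_zero (m : ThetaChar) {w : ℤ} {c : ℂ}
    (hphase : ∀ g : Fin 2 → ℤ, Complex.exp (Real.pi * Complex.I *
      (2 * w * (shifted m.1 g 0 * shifted m.1 g 1) +
        ((m.2 0).val * shifted m.1 g 0 + (m.2 1).val * shifted m.1 g 1))) = c) :
    theta m (line w) ≠ 0 := by
  have hc : c ≠ 0 := by rw [← hphase 0]; exact Complex.exp_ne_zero _
  let u : (Fin 2 → ℤ) → ℝ := fun g => Real.exp (-Real.pi *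
    (1 * ((g 0 + (m.1 0).val / 2) ^ 2 + (g 1 + (m.1 1).val / 2) ^ 2)))
  have hu : Summable u := summable_exp_neg_sq one_pos _ _
  have hterm : ∀ g, thetaTerm m (line w) g = c * (u g : ℂ) := by
    intro g
    rw [← hphase g, Complex.ofReal_exp, ← Complex.exp_add, thetaTerm]
    congr 1
    simp [line, shifted, dotProduct, mulVec, Fin.sum_univ_two, -ZMod.natCast_val]
    linear_combination (Real.pi * ((g 0 + (m.1 0).val / 2) ^ 2 + (g 1 + (m.1 1).val / 2) ^ 2) : ℂ)
      * Complex.I_sq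
  rw [theta_eq_tsum, tsum_congr hterm, tsum_mul_left, ← Complex.ofReal_tsum]
  refine mul_ne_zero hc (Complex.ofReal_ne_zero.2 (ne_of_gt ?_))
  exact hu.tsum_pos (fun g => (Real.exp_pos _).le) 0 (Real.exp_pos _)

lemma exists_theta_line_ne_zero {m : ThetaChar} (hm : m ∈ standardSextuple) :
    ∃ w : ℤ, theta m (line w) ≠ 0 := by
  have h : m.2 = 0 ∨ (m.2 0 = m.1 1 ∧ m.2 1 = m.1 0) := by
    revert hm; revert m; decide +kernel
  rcases h with h | ⟨h0, h1⟩
  · exact ⟨0, theta_line_ne_zero m (c := 1) fun g => by simp [h]⟩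
  · refine ⟨1, theta_line_ne_zero m (c := Complex.exp (Real.pi * Complex.I *
      (3 / 2 * ((m.1 0).val * (m.1 1).val)))) fun g => ?_⟩
    rw [h0, h1, ← mul_one (Complex.exp (_ * (3 / 2 * _))), ← exp_pi_mul_I_mul_two_mul_int
      (g 0 * g 1 + g 0 * (m.1 1).val + g 1 * (m.1 0).val), ← Complex.exp_add]
    congr 1
    simp [shifted]
    ring

/-- Restricted to the strip, the six factors are analytic functions of one variable, none of them
identically zero. -/
lemma exists_thetaProd_ne_zero : ∃ Z ∈ upperHalf, thetaProd standardSextuple Z ≠ 0 := by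
  by_contra! h
  set S : Set ℂ := {w : ℂ | |w.im| < 1 / 2} with hS
  have hopen : IsOpen S := isOpen_lt (by fun_prop) (by fun_prop)
  have hpre : IsPreconnected S := by
    have : S = Complex.imLm ⁻¹' Set.Ioo (-(1 / 2)) (1 / 2) := by
      ext w; simp [hS, abs_lt]
    rw [this]
    exact ((convex_Ioo _ _).linear_preimage _).isPreconnected
  have han : ∀ m, AnalyticOnNhd ℂ (fun w => theta m (line w)) S := fun m =>
    (differentiableOn_theta_line m).analyticOnNhd hopen
  have key : ∀ n : Finset ThetaChar, (∀ w ∈ S, ∏ m ∈ n, theta m (line w) = 0) →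
      ∃ m ∈ n, ∀ w ∈ S, theta m (line w) = 0 := by
    intro n
    induction n using Finset.induction_on with
    | empty => intro h0; simpa using h0 0 (by simp [hS])
    | insert m n hmn ih =>
      intro h0
      simp only [Finset.prod_insert hmn] at h0
      rcases (han m).eq_zero_or_eq_zero_of_mul_eq_zero
        (n.analyticOnNhd_fun_prod fun m _ => han m) h0 hpre with h1 | h1
      · exact ⟨m, Finset.mem_insert_self _ _, h1⟩
      · obtain ⟨m', hm', h2⟩ := ih h1
        exact ⟨m', Finset.mem_insert_of_mem hm', h2⟩
  obtain ⟨m, hm, h0⟩ := key standardSextuple fun w hw => h _ (line_mem hw)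
  obtain ⟨w, hw⟩ := exists_theta_line_ne_zero hm
  exact hw (h0 w (by simp [hS]))

lemma Carries.eq_of_standardSextuple {M : Gamma2} {c d : ℂ}
    (hc : Carries M standardSextuple standardSextuple c)
    (hd : Carries M standardSextuple standardSextuple d) : c = d := by
  obtain ⟨Z, hZ, h0⟩ := exists_thetaProd_ne_zero
  have h := (hc Z hZ).symm.trans (hd Z hZ)
  exact mul_right_cancel₀ (pow_ne_zero 3 (det_denom_ne_zero M hZ)) (mul_right_cancel₀ h0 h)

/-! ### Generators of the principal congruence subgroup of level two -/

lemma mem_principal_iff {l : ℕ} {M : Gamma2} :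
    M ∈ principal l ↔ ∀ i j, (l : ℤ) ∣ M.1 i j - (1 : Matrix (Fin 2 ⊕ Fin 2) _ ℤ) i j := by
  rw [principal, MonoidHom.mem_ker, Subtype.ext_iff, ← ext_iff]
  refine forall_congr' fun i => forall_congr' fun j => ?_
  rw [← ZMod.intCast_zmod_eq_zero_iff_dvd, Int.cast_sub, sub_eq_zero]
  have h : (((1 : Matrix (Fin 2 ⊕ Fin 2) (Fin 2 ⊕ Fin 2) ℤ) i j : ℤ) : ZMod l) =
      (1 : Matrix (Fin 2 ⊕ Fin 2) (Fin 2 ⊕ Fin 2) (ZMod l)) i j := by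
    rw [one_apply, one_apply]; split <;> simp
  rw [h]
  rfl

lemma exists_eq_one_add_of_mem_principal_two {M : Gamma2} (hM : M ∈ principal 2) :
    ∃ X : Matrix (Fin 2 ⊕ Fin 2) (Fin 2 ⊕ Fin 2) ℤ, M.1 = 1 + (X + X) := by
  choose X hX using mem_principal_iff.1 hM
  refine ⟨of X, ?_⟩
  ext i j
  have := hX i j
  rw [Matrix.add_apply, Matrix.add_apply, of_apply]
  push_cast at this
  linarith

lemma mem_principal_two_of_eq {M : Gamma2} {X : Matrix (Fin 2 ⊕ Fin 2) (Fin 2 ⊕ Fin 2) ℤ}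
    (h : M.1 = 1 + (X + X)) : M ∈ principal 2 := by
  refine mem_principal_iff.2 fun i j => ⟨X i j, ?_⟩
  rw [h, Matrix.add_apply, Matrix.add_apply]
  push_cast
  ring

/-- Modulo `4`, multiplication in `Γ₂[2]` is addition of the differences from the unit matrix. -/
lemma mul_apply_modEq {M N : Gamma2} (hM : M ∈ principal 2) (hN : N ∈ principal 2)
    (i j : Fin 2 ⊕ Fin 2) :
    (M * N).1 i j ≡ M.1 i j + N.1 i j - (1 : Matrix (Fin 2 ⊕ Fin 2) _ ℤ) i j [ZMOD 4] := by
  obtain ⟨X, hX⟩ := exists_eq_one_add_of_mem_principal_two hM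
  obtain ⟨Y, hY⟩ := exists_eq_one_add_of_mem_principal_two hN
  have h : (M * N).1 = 1 + (X + X) + (Y + Y) + (4 : ℤ) • (X * Y) := by
    change M.1 * N.1 = _
    rw [hX, hY]
    noncomm_ring
  rw [h, hX, hY]
  refine (Int.modEq_iff_dvd.2 ⟨-(X * Y) i j, ?_⟩)
  simp only [Matrix.add_apply, Matrix.smul_apply, smul_eq_mul]
  ring

/-- Even symplectic translations in both directions and the unimodular substitutions congruent
to `1` modulo `2`. -/
def evenGenerators : Set Gamma2 :=
  {M | (∃ p q r, M = upper (2 * p) (2 * q) (2 * r)) ∨ (∃ p q r, M = lower (2 * p) (2 * q) (2 * r)) ∨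
    ∃ U W h, M = levi U (1 + (W + W)) h}

lemma upper_mem (p q r : ℤ) :
    upper (2 * p) (2 * q) (2 * r) ∈ Subgroup.closure evenGenerators :=
  Subgroup.subset_closure (Or.inl ⟨p, q, r, rfl⟩)

lemma lower_mem (p q r : ℤ) :
    lower (2 * p) (2 * q) (2 * r) ∈ Subgroup.closure evenGenerators :=
  Subgroup.subset_closure (Or.inr (Or.inl ⟨p, q, r, rfl⟩))

lemma levi_mem (U W : Matrix (Fin 2) (Fin 2) ℤ) (h : (1 + (W + W)) * U = 1) :
    levi U _ h ∈ Subgroup.closure evenGenerators :=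
  Subgroup.subset_closure (Or.inr (Or.inr ⟨U, W, h, rfl⟩))

lemma upper_mem_principal (p q r : ℤ) : upper (2 * p) (2 * q) (2 * r) ∈ principal 2 := by
  refine mem_principal_two_of_eq (X := fromBlocks 0 !![p, q; q, r] 0 0) ?_
  simp [upper, ← fromBlocks_one, fromBlocks_add, two_mul]

lemma lower_mem_principal (p q r : ℤ) : lower (2 * p) (2 * q) (2 * r) ∈ principal 2 := by
  refine mem_principal_two_of_eq (X := fromBlocks 0 0 !![p, q; q, r] 0) ?_
  simp [lower, ← fromBlocks_one, fromBlocks_add, two_mul]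

lemma levi_mem_principal (U W : Matrix (Fin 2) (Fin 2) ℤ) (h : (1 + (W + W)) * U = 1) :
    levi U _ h ∈ principal 2 := by
  refine mem_principal_two_of_eq (X := fromBlocks (-(W * U)) 0 0 Wᵀ) ?_
  have hU : U = 1 + (-(W * U) + -(W * U)) := by
    rw [add_mul, one_mul, add_mul] at h
    rw [← h]
    abel
  simp only [levi, ← fromBlocks_one, fromBlocks_add, ← hU, transpose_add, transpose_one, add_zero]

lemma upper_mul_apply (p q r : ℤ) (M : Gamma2) (j : Fin 2 ⊕ Fin 2) :
    (upper p q r * M).1 (.inl 0) j = M.1 (.inl 0) j + p * M.1 (.inr 0) j + q * M.1 (.inr 1) j ∧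
    (upper p q r * M).1 (.inl 1) j = M.1 (.inl 1) j + q * M.1 (.inr 0) j + r * M.1 (.inr 1) j ∧
    (upper p q r * M).1 (.inr 0) j = M.1 (.inr 0) j ∧
    (upper p q r * M).1 (.inr 1) j = M.1 (.inr 1) j := by
  simp [upper, mul_apply, Fin.sum_univ_two, one_apply, add_assoc]

lemma lower_mul_apply (p q r : ℤ) (M : Gamma2) (j : Fin 2 ⊕ Fin 2) :
    (lower p q r * M).1 (.inl 0) j = M.1 (.inl 0) j ∧
    (lower p q r * M).1 (.inl 1) j = M.1 (.inl 1) j ∧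
    (lower p q r * M).1 (.inr 0) j = M.1 (.inr 0) j + p * M.1 (.inl 0) j + q * M.1 (.inl 1) j ∧
    (lower p q r * M).1 (.inr 1) j = M.1 (.inr 1) j + q * M.1 (.inl 0) j + r * M.1 (.inl 1) j := by
  simp [lower, mul_apply, Fin.sum_univ_two, one_apply]
  constructor <;> ring

lemma levi_mul_apply (U V : Matrix (Fin 2) (Fin 2) ℤ) (h : V * U = 1) (M : Gamma2)
    (j : Fin 2 ⊕ Fin 2) (i : Fin 2) :
    (levi U V h * M).1 (.inl i) j = U i 0 * M.1 (.inl 0) j + U i 1 * M.1 (.inl 1) j ∧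
    (levi U V h * M).1 (.inr i) j = V 0 i * M.1 (.inr 0) j + V 1 i * M.1 (.inr 1) j := by
  simp [levi, mul_apply, Fin.sum_univ_two]

/-- The unimodular substitution adding `2k` times the second coordinate to the first. -/
def shearUp (k : ℤ) : Gamma2 :=
  levi !![1, 2 * k; 0, 1] (1 + (!![0, -k; 0, 0] + !![0, -k; 0, 0])) (by
    ext i j; fin_cases i <;> fin_cases j <;> simp [mul_apply, Fin.sum_univ_two]; ring)

/-- The unimodular substitution adding `2k` times the first coordinate to the second. -/
def shearDown (k : ℤ) : Gamma2 :=
  levi !![1, 0; 2 * k, 1] (1 + (!![0, 0; -k, 0] + !![0, 0; -k, 0])) (by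
    ext i j; fin_cases i <;> fin_cases j <;> simp [mul_apply, Fin.sum_univ_two]; ring)

/-- The sign change of the first coordinate. -/
def signFst : Gamma2 :=
  levi !![-1, 0; 0, 1] (1 + (!![-1, 0; 0, 0] + !![-1, 0; 0, 0])) (by decide)

/-- The sign change of the second coordinate. -/
def signSnd : Gamma2 :=
  levi !![1, 0; 0, -1] (1 + (!![0, 0; 0, -1] + !![0, 0; 0, -1])) (by decide)

lemma shearUp_mul_apply (k : ℤ) (M : Gamma2) (j : Fin 2 ⊕ Fin 2) :
    (shearUp k * M).1 (.inl 0) j = M.1 (.inl 0) j + 2 * k * M.1 (.inl 1) j ∧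
    (shearUp k * M).1 (.inl 1) j = M.1 (.inl 1) j ∧
    (shearUp k * M).1 (.inr 0) j = M.1 (.inr 0) j ∧
    (shearUp k * M).1 (.inr 1) j = M.1 (.inr 1) j - 2 * k * M.1 (.inr 0) j := by
  simp only [shearUp, levi_mul_apply]
  simp
  ring

lemma shearDown_mul_apply (k : ℤ) (M : Gamma2) (j : Fin 2 ⊕ Fin 2) :
    (shearDown k * M).1 (.inl 0) j = M.1 (.inl 0) j ∧
    (shearDown k * M).1 (.inl 1) j = M.1 (.inl 1) j + 2 * k * M.1 (.inl 0) j := by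
  simp only [shearDown, levi_mul_apply]
  simp
  ring

/-- One step of the Euclidean algorithm with even quotients: an odd `a` either eliminates an even
`b`, or can be made smaller. -/
lemma euclid_step {a b : ℤ} (ha : Odd a) (hb : Even b) :
    ∃ k, b + 2 * k * a = 0 ∨ ∃ l, (a + 2 * l * (b + 2 * k * a)).natAbs < a.natAbs := by
  have key : ∀ x y : ℤ, y ≠ 0 → ∃ k, (x + 2 * k * y).natAbs ≤ y.natAbs := by
    intro x y hy
    have h1 : x.bmod (2 * y.natAbs) = x - (2 * y.natAbs : ℕ) * x.bdiv (2 * y.natAbs) :=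
      Int.bmod_eq_self_sub_mul_bdiv _ _
    have h2 := Int.le_bmod (x := x) (m := 2 * y.natAbs) (by omega)
    have h3 := Int.bmod_le (x := x) (m := 2 * y.natAbs) (by omega)
    have h4 : x + 2 * (-(y.sign * x.bdiv (2 * y.natAbs))) * y = x.bmod (2 * y.natAbs) := by
      rw [h1]
      push_cast
      rw [← Int.sign_mul_self_eq_abs y]
      ring
    refine ⟨-(y.sign * x.bdiv (2 * y.natAbs)), ?_⟩
    rw [h4]
    omega
  obtain ⟨k, hk⟩ := key b a (by rintro rfl; simp at ha)
  refine ⟨k, ?_⟩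
  by_cases h0 : b + 2 * k * a = 0
  · exact Or.inl h0
  · right
    obtain ⟨l, hl⟩ := key a _ h0
    refine ⟨l, lt_of_le_of_lt hl (lt_of_le_of_ne hk fun h => ?_)⟩
    have he : Even (b + 2 * k * a) := hb.add (by rw [mul_assoc]; exact even_two_mul _)
    rw [← Int.natAbs_even, h, Int.natAbs_even] at he
    exact Int.not_even_iff_odd.2 ha he

lemma odd_diag_of_mem_principal {M : Gamma2} (hM : M ∈ principal 2) (i : Fin 2 ⊕ Fin 2) :
    Odd (M.1 i i) := by
  have h := mem_principal_iff.1 hM i i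
  rw [one_apply_eq] at h
  rw [Int.odd_iff]
  omega

lemma even_off_diag_of_mem_principal {M : Gamma2} (hM : M ∈ principal 2) {i j : Fin 2 ⊕ Fin 2}
    (hij : i ≠ j) : Even (M.1 i j) := by
  have h := mem_principal_iff.1 hM i j
  rw [one_apply_ne hij] at h
  rw [Int.even_iff]
  omega

lemma closure_evenGenerators_le : Subgroup.closure evenGenerators ≤ principal 2 := by
  rw [Subgroup.closure_le]
  rintro M (⟨p, q, r, rfl⟩ | ⟨p, q, r, rfl⟩ | ⟨U, W, h, rfl⟩)
  · exact upper_mem_principal p q r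
  · exact lower_mem_principal p q r
  · exact levi_mem_principal U W h

lemma isUnit_of_column {M : Gamma2} {i j : Fin 2 ⊕ Fin 2} (h : ∀ k, k ≠ i → M.1 k j = 0) :
    M.1 i j = 1 ∨ M.1 i j = -1 := by
  have h1 : (M⁻¹ * M).1 j j = 1 := by rw [inv_mul_cancel]; exact one_apply_eq j
  have h2 : (M⁻¹ * M).1 j j = M⁻¹.1 j i * M.1 i j := by
    change (M⁻¹.1 * M.1) j j = _
    rw [mul_apply]
    exact Finset.sum_eq_single i (fun k _ hk => by rw [h k hk, mul_zero]) (by simp)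
  rw [h1, mul_comm] at h2
  exact Int.eq_one_or_neg_one_of_mul_eq_one h2.symm

/-- Euclidean reduction of the first column; the induction is on the size of its top entry. -/
lemma exists_mul_first_column (N : ℕ) : ∀ M ∈ principal 2, (M.1 (.inl 0) (.inl 0)).natAbs = N →
    ∃ g ∈ Subgroup.closure evenGenerators, (g * M).1 (.inl 0) (.inl 0) = 1 ∧
      (g * M).1 (.inl 1) (.inl 0) = 0 ∧ (g * M).1 (.inr 0) (.inl 0) = 0 ∧
      (g * M).1 (.inr 1) (.inl 0) = 0 := by
  induction N using Nat.strong_induction_on with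
  | _ N ih =>
  intro M hM hN
  have descend : ∀ g ∈ Subgroup.closure evenGenerators,
      ((g * M).1 (.inl 0) (.inl 0)).natAbs < N → ∃ g ∈ Subgroup.closure evenGenerators,
      (g * M).1 (.inl 0) (.inl 0) = 1 ∧ (g * M).1 (.inl 1) (.inl 0) = 0 ∧
      (g * M).1 (.inr 0) (.inl 0) = 0 ∧ (g * M).1 (.inr 1) (.inl 0) = 0 := by
    intro g hg hlt
    obtain ⟨g', hg', h⟩ :=
      ih _ hlt (g * M) (mul_mem (closure_evenGenerators_le hg) hM) rfl
    exact ⟨g' * g, mul_mem hg' hg, by rw [mul_assoc]; exact h⟩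
  -- clear the second entry
  obtain ⟨k, hk⟩ := euclid_step (odd_diag_of_mem_principal hM (.inl 0))
    (even_off_diag_of_mem_principal hM (i := .inl 1) (j := .inl 0) (by simp))
  have hgk : shearDown k ∈ Subgroup.closure evenGenerators := levi_mem _ _ _
  obtain ⟨a1, a2⟩ := shearDown_mul_apply k M (.inl 0)
  rcases hk with hk | ⟨l, hl⟩
  swap
  · refine descend (shearUp l * shearDown k) (mul_mem (levi_mem _ _ _) hgk) ?_
    rw [mul_assoc, (shearUp_mul_apply l _ _).1, a1, a2, ← hN]
    exact hl
  rw [hk] at a2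
  have hM1 := mul_mem (closure_evenGenerators_le hgk) hM
  set M1 := shearDown k * M with hM1def
  -- clear the fourth entry
  obtain ⟨k₂, hk₂⟩ := euclid_step (odd_diag_of_mem_principal hM1 (.inl 0))
    (even_off_diag_of_mem_principal hM1 (i := .inr 1) (j := .inl 0) (by simp))
  obtain ⟨b1, b2, -, b4⟩ := lower_mul_apply (2 * 0) (2 * k₂) (2 * 0) M1 (.inl 0)
  replace b4 := b4.trans (show _ = M1.1 (.inr 1) (.inl 0) + 2 * k₂ * M1.1 (.inl 0) (.inl 0) by
    rw [a2]; ring)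
  rcases hk₂ with hk₂ | ⟨l, hl⟩
  swap
  · refine descend (upper (2 * 0) (2 * l) (2 * 0) * (lower (2 * 0) (2 * k₂) (2 * 0) * shearDown k))
      (mul_mem (upper_mem _ _ _) (mul_mem (lower_mem _ _ _) hgk)) ?_
    rw [mul_assoc, mul_assoc, ← hM1def, (upper_mul_apply _ _ _ _ _).1, b1, b4, ← hN, ← a1]
    simpa using hl
  rw [hk₂] at b4
  have hM2 := mul_mem (lower_mem_principal 0 k₂ 0) hM1
  set M2 := lower (2 * 0) (2 * k₂) (2 * 0) * M1 with hM2def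
  rw [a2] at b2
  -- clear the third entry
  obtain ⟨k₃, hk₃⟩ := euclid_step (odd_diag_of_mem_principal hM2 (.inl 0))
    (even_off_diag_of_mem_principal hM2 (i := .inr 0) (j := .inl 0) (by simp))
  obtain ⟨c1, c2, c3, c4⟩ := lower_mul_apply (2 * k₃) (2 * 0) (2 * 0) M2 (.inl 0)
  replace c3 := c3.trans (show _ = M2.1 (.inr 0) (.inl 0) + 2 * k₃ * M2.1 (.inl 0) (.inl 0) by
    rw [b2]; ring)
  replace c4 := c4.trans (show _ = M2.1 (.inr 1) (.inl 0) by rw [b2]; ring)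
  have hgk' : lower (2 * k₃) (2 * 0) (2 * 0) * (lower (2 * 0) (2 * k₂) (2 * 0) * shearDown k) ∈
      Subgroup.closure evenGenerators :=
    mul_mem (lower_mem _ _ _) (mul_mem (lower_mem _ _ _) hgk)
  rcases hk₃ with hk₃ | ⟨l, hl⟩
  swap
  · refine descend (upper (2 * l) (2 * 0) (2 * 0) * _) (mul_mem (upper_mem _ _ _) hgk') ?_
    rw [mul_assoc, mul_assoc, mul_assoc, ← hM1def, ← hM2def, (upper_mul_apply _ _ _ _ _).1, c1, c3,
      ← hN, ← a1, ← b1]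
    simpa using hl
  rw [hk₃] at c3
  rw [b4] at c4
  rw [b2] at c2
  set M3 := lower (2 * k₃) (2 * 0) (2 * 0) * M2 with hM3def
  have hM3 : M3 = lower (2 * k₃) (2 * 0) (2 * 0) *
      (lower (2 * 0) (2 * k₂) (2 * 0) * shearDown k) * M := by
    rw [mul_assoc, mul_assoc]
  have hunit : M3.1 (.inl 0) (.inl 0) = 1 ∨ M3.1 (.inl 0) (.inl 0) = -1 := by
    refine isUnit_of_column fun i hi => ?_
    rcases i with i | i <;> fin_cases i
    · exact absurd rfl hi
    · exact c2
    · exact c3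
    · exact c4
  rcases hunit with h | h
  · exact ⟨_, hgk', by rw [← hM3]; exact ⟨h, c2, c3, c4⟩⟩
  · refine ⟨signFst * _, mul_mem (levi_mem _ _ _) hgk', ?_⟩
    rw [mul_assoc, ← hM3]
    simp only [signFst, levi_mul_apply, c2, c3, c4, h]
    simp

lemma third_row_of_first_column {M : Gamma2} (h0 : M.1 (.inl 0) (.inl 0) = 1)
    (h1 : M.1 (.inl 1) (.inl 0) = 0) (h2 : M.1 (.inr 0) (.inl 0) = 0)
    (h3 : M.1 (.inr 1) (.inl 0) = 0) : M.1 (.inr 0) (.inl 1) = 0 := by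
  have h := congrFun (congrFun (block_relations M).1 0) 1
  simpa [mul_apply, Fin.sum_univ_two, toBlocks₁₁, toBlocks₂₁, h0, h1, h2, h3] using h

/-- Reduction of the second column by elements fixing the first unit vector. -/
lemma exists_mul_second_column (N : ℕ) : ∀ M ∈ principal 2, (M.1 (.inl 1) (.inl 1)).natAbs = N →
    M.1 (.inl 0) (.inl 0) = 1 → M.1 (.inl 1) (.inl 0) = 0 → M.1 (.inr 0) (.inl 0) = 0 →
    M.1 (.inr 1) (.inl 0) = 0 →
    ∃ g ∈ Subgroup.closure evenGenerators, (g * M).1.toBlocks₁₁ = 1 ∧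
      (g * M).1.toBlocks₂₁ = 0 := by
  induction N using Nat.strong_induction_on with
  | _ N ih =>
  intro M hM hN h0 h1 h2 h3
  obtain ⟨k, hk⟩ := euclid_step (odd_diag_of_mem_principal hM (.inl 1))
    (even_off_diag_of_mem_principal hM (i := .inr 1) (j := .inl 1) (by simp))
  have hM1 := mul_mem (lower_mem_principal 0 0 k) hM
  set M1 := lower (2 * 0) (2 * 0) (2 * k) * M with hM1def
  obtain ⟨a1, a2, a3, a4⟩ := lower_mul_apply (2 * 0) (2 * 0) (2 * k) M (.inl 0)
  obtain ⟨b1, b2, b3, b4⟩ := lower_mul_apply (2 * 0) (2 * 0) (2 * k) M (.inl 1)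
  rw [← hM1def] at a1 a2 a3 a4 b1 b2 b3 b4
  simp only [h0, h1, h2, h3, mul_zero, add_zero, zero_mul] at a1 a2 a3 a4 b4
  have b3' := third_row_of_first_column a1 a2 a3 a4
  rcases hk with hk | ⟨l, hl⟩
  swap
  · have hM2 := mul_mem (upper_mem_principal 0 0 l) hM1
    obtain ⟨c1, c2, c3, c4⟩ := upper_mul_apply (2 * 0) (2 * 0) (2 * l) M1 (.inl 0)
    obtain ⟨-, d2, -, -⟩ := upper_mul_apply (2 * 0) (2 * 0) (2 * l) M1 (.inl 1)
    obtain ⟨g, hg, h⟩ := ih _ (by rw [d2, b3', b2, b4, ← hN]; simpa using hl) _ hM2 rfl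
      (by rw [c1, a1, a3, a4]; simp) (by rw [c2, a2, a3, a4]; simp) (by rw [c3, a3])
      (by rw [c4, a4])
    refine ⟨g * (upper (2 * 0) (2 * 0) (2 * l) * lower (2 * 0) (2 * 0) (2 * k)),
      mul_mem hg (mul_mem (upper_mem _ _ _) (lower_mem _ _ _)), ?_⟩
    rwa [mul_assoc, mul_assoc, ← hM1def]
  rw [hk] at b4
  -- the reduced matrix has `C = 0`, hence a unit in position `(2, 2)`
  have hunit : M1.1 (.inl 1) (.inl 1) = 1 ∨ M1.1 (.inl 1) (.inl 1) = -1 := by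
    have h := congrFun (congrFun (block_relations M1).2.2 1) 1
    simp [mul_apply, Fin.sum_univ_two, toBlocks₁₁, toBlocks₂₂, toBlocks₁₂, toBlocks₂₁,
      b3', b4] at h
    have h' := congrFun (congrFun (block_relations M1).2.2 0) 1
    simp [mul_apply, Fin.sum_univ_two, toBlocks₁₁, toBlocks₂₂, toBlocks₁₂, toBlocks₂₁,
      a1, a2, a3, a4] at h'
    rw [h', mul_zero, zero_add] at h
    exact Int.eq_one_or_neg_one_of_mul_eq_one h
  have main : ∀ M2 ∈ principal 2, M2.1 (.inl 0) (.inl 0) = 1 → M2.1 (.inl 1) (.inl 0) = 0 →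
      M2.1 (.inr 0) (.inl 0) = 0 → M2.1 (.inr 1) (.inl 0) = 0 → M2.1 (.inl 1) (.inl 1) = 1 →
      M2.1 (.inr 0) (.inl 1) = 0 → M2.1 (.inr 1) (.inl 1) = 0 →
      ∃ g ∈ Subgroup.closure evenGenerators, (g * M2).1.toBlocks₁₁ = 1 ∧
      (g * M2).1.toBlocks₂₁ = 0 := by
    intro M2 hM2 e1 e2 e3 e4 f2 f3 f4
    obtain ⟨x, hx⟩ := even_off_diag_of_mem_principal hM2 (i := .inl 0) (j := .inl 1) (by simp)
    obtain ⟨s1, s2, s3, s4⟩ := shearUp_mul_apply (-x) M2 (.inl 0)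
    obtain ⟨t1, t2, t3, t4⟩ := shearUp_mul_apply (-x) M2 (.inl 1)
    rw [e1, e2, mul_zero, add_zero] at s1
    rw [e2] at s2
    rw [e3] at s3
    rw [e3, e4, mul_zero, sub_zero] at s4
    rw [hx, f2, show x + x + 2 * -x * 1 = 0 by ring] at t1
    rw [f2] at t2
    rw [f3] at t3
    rw [f3, f4, mul_zero, sub_zero] at t4
    refine ⟨shearUp (-x), levi_mem _ _ _, ?_, ?_⟩
    · ext i j
      fin_cases i <;> fin_cases j
      exacts [s1, t1, s2, t2]
    · ext i j
      fin_cases i <;> fin_cases j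
      exacts [s3, t3, s4, t4]
  rcases hunit with h | h
  · obtain ⟨g, hg, h⟩ := main M1 hM1 a1 a2 a3 a4 h b3' b4
    exact ⟨g * lower (2 * 0) (2 * 0) (2 * k), mul_mem hg (lower_mem _ _ _), by rwa [mul_assoc]⟩
  · have hM2 := mul_mem (levi_mem_principal _ _ (by decide) : signSnd ∈ principal 2) hM1
    obtain ⟨g, hg, h⟩ := main _ hM2
      (by simp only [levi_mul_apply, a1, a2]; simp)
      (by simp only [levi_mul_apply, a1, a2]; simp)
      (by simp only [levi_mul_apply, a3, a4]; simp)
      (by simp only [levi_mul_apply, a3, a4]; simp)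
      (by simp only [levi_mul_apply, h]; simp)
      (by simp only [levi_mul_apply, b3', b4]; simp)
      (by simp only [levi_mul_apply, b3', b4]; simp)
    exact ⟨g * (signSnd * lower (2 * 0) (2 * 0) (2 * k)),
      mul_mem hg (mul_mem (levi_mem _ _ _) (lower_mem _ _ _)), by rwa [mul_assoc, mul_assoc]⟩

lemma mem_closure_evenGenerators_of_blocks {M : Gamma2} (hM : M ∈ principal 2)
    (hA : M.1.toBlocks₁₁ = 1)
    (hC : M.1.toBlocks₂₁ = 0) : M ∈ Subgroup.closure evenGenerators := by
  obtain ⟨-, h2, h3⟩ := block_relations M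
  rw [hA, hC, transpose_one, transpose_zero, one_mul, zero_mul, sub_zero] at h3
  rw [h3, mul_one, transpose_one, one_mul] at h2
  obtain ⟨p, hp⟩ := even_off_diag_of_mem_principal hM (i := .inl 0) (j := .inr 0) (by simp)
  obtain ⟨q, hq⟩ := even_off_diag_of_mem_principal hM (i := .inl 0) (j := .inr 1) (by simp)
  obtain ⟨r, hr⟩ := even_off_diag_of_mem_principal hM (i := .inl 1) (j := .inr 1) (by simp)
  have hq' : M.1 (.inl 1) (.inr 0) = q + q := (congrFun (congrFun h2 0) 1).trans hq
  have : M = upper (2 * p) (2 * q) (2 * r) := by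
    apply Subtype.ext
    rw [← fromBlocks_toBlocks M.1, hA, hC, h3, upper]
    congr 1
    ext i j
    fin_cases i <;> fin_cases j <;> simp [toBlocks₁₂, hp, hq, hr, hq', two_mul]
  rw [this]
  exact upper_mem p q r

theorem closure_evenGenerators : Subgroup.closure evenGenerators = principal 2 := by
  refine le_antisymm closure_evenGenerators_le fun M hM => ?_
  obtain ⟨g, hg, h0, h1, h2, h3⟩ := exists_mul_first_column _ M hM rfl
  have hgM := mul_mem (closure_evenGenerators_le hg) hM
  obtain ⟨g', hg', hA, hC⟩ := exists_mul_second_column _ _ hgM rfl h0 h1 h2 h3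
  have h := mem_closure_evenGenerators_of_blocks (mul_mem (closure_evenGenerators_le hg') hgM) hA hC
  rwa [Subgroup.mul_mem_cancel_left _ hg', Subgroup.mul_mem_cancel_left _ hg] at h

/-! ### The multiplier on the principal congruence subgroup of level two -/

/-- The sum of the entries on and above the diagonal of `C`. On `Γ₂[2]` it is congruent to
`α + β + γ` modulo `4`. -/
def lowerSum (M : Gamma2) : ℤ :=
  M.1 (.inr 0) (.inl 0) + M.1 (.inr 0) (.inl 1) + M.1 (.inr 1) (.inl 1)

lemma lowerSum_mul_modEq {M N : Gamma2} (hM : M ∈ principal 2) (hN : N ∈ principal 2) :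
    lowerSum (M * N) ≡ lowerSum M + lowerSum N [ZMOD 4] := by
  have h := ((mul_apply_modEq hM hN (.inr 0) (.inl 0)).add
    (mul_apply_modEq hM hN (.inr 0) (.inl 1))).add (mul_apply_modEq hM hN (.inr 1) (.inl 1))
  have h0 : ∀ i j : Fin 2, (1 : Matrix (Fin 2 ⊕ Fin 2) (Fin 2 ⊕ Fin 2) ℤ) (.inr i) (.inl j) = 0 :=
    fun _ _ => one_apply_ne Sum.inr_ne_inl
  rw [h0, h0, h0] at h
  convert h using 1
  · rfl
  · rw [lowerSum, lowerSum]
    ring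

lemma lowerSum_modEq {M : Gamma2} (hM : M ∈ principal 2) :
    (M.1.toBlocks₂₁ * M.1.toBlocks₂₂ᵀ) 0 0 + (M.1.toBlocks₂₁ * M.1.toBlocks₂₂ᵀ) 0 1 +
      (M.1.toBlocks₂₁ * M.1.toBlocks₂₂ᵀ) 1 1 ≡ lowerSum M [ZMOD 4] := by
  obtain ⟨X, hX⟩ := exists_eq_one_add_of_mem_principal_two hM
  rw [lowerSum, hX]
  refine Int.modEq_iff_dvd.2 ⟨-((X.toBlocks₂₁ * X.toBlocks₂₂ᵀ) 0 0 +
    (X.toBlocks₂₁ * X.toBlocks₂₂ᵀ) 0 1 + (X.toBlocks₂₁ * X.toBlocks₂₂ᵀ) 1 1), ?_⟩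
  simp [mul_apply, Fin.sum_univ_two, toBlocks₂₁, toBlocks₂₂, one_apply]
  ring

lemma isSymm_mul_transpose (M : Gamma2) : (M.1.toBlocks₂₁ * M.1.toBlocks₂₂ᵀ).IsSymm := by
  have h := SymplecticGroup.transpose_mem M.2
  rw [← fromBlocks_toBlocks M.1, fromBlocks_transpose] at h
  have h2 := (SymplecticGroup.fromBlocks_mem_iff.1 h).2.1
  rw [transpose_transpose, transpose_transpose] at h2
  rw [IsSymm, transpose_mul, transpose_transpose, h2]

lemma exists_carries_of_mem_principal_two {M : Gamma2} (hM : M ∈ principal 2) :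
    ∃ e : ℤ, lowerSum M ≡ 2 * e [ZMOD 4] ∧
      Carries M standardSextuple standardSextuple ((-1) ^ e) := by
  suffices h : M ∈ principal 2 ∧ ∃ e : ℤ, lowerSum M ≡ 2 * e [ZMOD 4] ∧
      Carries M standardSextuple standardSextuple ((-1) ^ e) from h.2
  rw [← closure_evenGenerators] at hM
  induction hM using Subgroup.closure_induction with
  | mem M h =>
    refine ⟨closure_evenGenerators_le (Subgroup.subset_closure h), ?_⟩
    rcases h with ⟨p, q, r, rfl⟩ | ⟨p, q, r, rfl⟩ | ⟨U, W, h, rfl⟩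
    · exact ⟨0, by simp [lowerSum, upper], by simpa using carries_upper_standardSextuple p q r⟩
    · refine ⟨p + q + r, ?_, carries_lower p q r⟩
      have h : lowerSum (lower (2 * p) (2 * q) (2 * r)) = 2 * (p + q + r) := by
        simp [lowerSum, lower]
        ring
      rw [h]
    · exact ⟨0, by simp [lowerSum, levi], by simpa using carries_levi U W h⟩
  | one =>
    exact ⟨one_mem _, 0, by simp [lowerSum, one_apply], by simpa using carries_one _⟩
  | mul M N _ _ hM hN =>
    obtain ⟨hM, e, he, hMe⟩ := hM
    obtain ⟨hN, f, hf, hNf⟩ := hN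
    refine ⟨mul_mem hM hN, e + f, ?_, ?_⟩
    · rw [mul_add]
      exact (lowerSum_mul_modEq hM hN).trans (he.add hf)
    · rw [zpow_add₀ (by norm_num)]
      exact hMe.mul hNf
  | inv M _ hM =>
    obtain ⟨hM, e, he, hMe⟩ := hM
    refine ⟨inv_mem hM, -e, ?_, ?_⟩
    · have h := lowerSum_mul_modEq hM (inv_mem hM)
      rw [mul_inv_cancel, show lowerSum 1 = 0 by simp [lowerSum, one_apply]] at h
      have h2 := (h.trans (he.add_right _)).symm.sub_right (2 * e)
      rw [mul_neg]
      simpa using h2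
    · rw [_root_.zpow_neg]
      exact hMe.inv (zpow_ne_zero _ (by norm_num))

lemma mem_Gamma_iff {M : Gamma2} (hM : M ∈ principal 2) :
    M ∈ Gamma standardSextuple ↔ lowerSum M ≡ 0 [ZMOD 4] := by
  obtain ⟨e, he, hMe⟩ := exists_carries_of_mem_principal_two hM
  have h1 : M ∈ Gamma standardSextuple ↔ Even e := by
    constructor
    · intro h
      by_contra h'
      have h2 := hMe.eq_of_standardSextuple h.2
      rw [(Int.not_even_iff_odd.1 h').neg_one_zpow] at h2
      norm_num at h2
    · intro h
      rw [h.neg_one_zpow] at hMe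
      exact ⟨hM, hMe⟩
  rw [h1]
  constructor
  · rintro ⟨f, rfl⟩
    exact he.trans (Int.modEq_zero_iff_dvd.2 ⟨f, by ring⟩)
  · intro h
    have := Int.modEq_zero_iff_dvd.1 (he.symm.trans h)
    rw [Int.even_iff]
    omega

/-! ### Generators of the kernel of the multiplier -/

lemma principal_four_le : principal 4 ≤ principal 2 := fun M hM =>
  mem_principal_iff.2 fun i j => dvd_trans (by norm_num) (mem_principal_iff.1 hM i j)

lemma principal_four_subset_Gamma {M : Gamma2} (hM : M ∈ principal 4) :
    M ∈ Gamma standardSextuple := by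
  rw [mem_Gamma_iff (principal_four_le hM), Int.modEq_zero_iff_dvd, lowerSum]
  have h := mem_principal_iff.1 hM
  have h1 := h (.inr 0) (.inl 0)
  have h2 := h (.inr 0) (.inl 1)
  have h3 := h (.inr 1) (.inl 1)
  simp only [one_apply_ne (Sum.inr_ne_inl), sub_zero] at h1 h2 h3
  exact dvd_add (dvd_add h1 h2) h3

/-- The kernel of the multiplier, as a subgroup. -/
def kernel : Subgroup Gamma2 where
  carrier := Gamma standardSextuple
  one_mem' := ⟨one_mem _, carries_one _⟩
  mul_mem' := fun {M N} hM hN => ⟨mul_mem hM.1 hN.1, by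
    have h := Carries.mul (M := M) (N := N) hM.2 hN.2
    rwa [one_mul] at h⟩
  inv_mem' := fun {M} hM => ⟨inv_mem hM.1, by
    have h := Carries.inv (M := M) hM.2 one_ne_zero
    rwa [inv_one] at h⟩

/-- The three families of elements generating the kernel of the multiplier: `Γ₂[4]`, and the
elements of the kernel on `Γ_{2,0}[2]` conjugate to `diagElt` or to a translation in `Γ₂[2]`. -/
def kernelGenerators : Set Gamma2 :=
  (principal 4 : Set Gamma2) ∪
    {M | M ∈ heckeKer standardSextuple ∧ IsConj diagElt M} ∪
    {M | M ∈ heckeKer standardSextuple ∧ ∃ N ∈ principal 2, IsTranslation N ∧ IsConj N M}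

lemma mem_principal_of_isConj {l : ℕ} {M N : Gamma2} (hN : N ∈ principal l) (h : IsConj N M) :
    M ∈ principal l := by
  obtain ⟨c, rfl⟩ := isConj_iff.1 h
  exact (MonoidHom.normal_ker (reduction l)).conj_mem _ hN c

lemma diagElt_mem : diagElt ∈ principal 2 := by
  rw [mem_principal_iff]
  decide

lemma closure_kernelGenerators_le : Subgroup.closure kernelGenerators ≤ kernel := by
  rw [Subgroup.closure_le]
  rintro M ((hM | ⟨hM, hc⟩) | ⟨hM, N, hN, -, hc⟩)
  · exact principal_four_subset_Gamma hM
  · exact ⟨mem_principal_of_isConj diagElt_mem hc, hM.2⟩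
  · exact ⟨mem_principal_of_isConj hN hc, hM.2⟩

lemma mem_heckeKer_of_lowerSum {M : Gamma2} (hM : M ∈ principal 2)
    (h : lowerSum M ≡ 0 [ZMOD 4]) : M ∈ heckeKer standardSextuple := by
  refine ⟨fun i j => ?_, ((mem_Gamma_iff hM).2 h).2⟩
  have := mem_principal_iff.1 hM (.inr i) (.inl j)
  rwa [one_apply_ne Sum.inr_ne_inl, sub_zero] at this

lemma upper_mem_closure_kernelGenerators (p q r : ℤ) :
    upper (2 * p) (2 * q) (2 * r) ∈ Subgroup.closure kernelGenerators := by
  refine Subgroup.subset_closure (Or.inr ⟨mem_heckeKer_of_lowerSum (upper_mem_principal p q r) ?_,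
    _, upper_mem_principal p q r, ⟨_, rfl⟩, .refl _⟩)
  simp [lowerSum, upper]

lemma lower_mem_closure_kernelGenerators {p q r : ℤ} (h : Even (p + q + r)) :
    lower (2 * p) (2 * q) (2 * r) ∈ Subgroup.closure kernelGenerators := by
  refine Subgroup.subset_closure (Or.inr ⟨mem_heckeKer_of_lowerSum (lower_mem_principal p q r) ?_,
    upper (2 * -p) (2 * -q) (2 * -r), upper_mem_principal _ _ _, ⟨_, rfl⟩,
    isConj_iff.2 ⟨inversion⁻¹, ?_⟩⟩)
  · obtain ⟨e, he⟩ := h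
    refine Int.modEq_zero_iff_dvd.2 ⟨e, ?_⟩
    simp [lowerSum, lower]
    linarith
  · rw [inv_inv, lower_eq_conj]
    simp only [mul_neg]

/-- The reflections `V diag(1, -1) V⁻¹` in `GL₂(ℤ)` give elements conjugate to `diagElt`. -/
lemma levi_mem_closure_kernelGenerators (U V W : Matrix (Fin 2) (Fin 2) ℤ)
    (hVW : W * V = 1) (hU : U * U = 1) (hUV : U * V = V * diagonal ![1, -1])
    (h2 : ∃ X, U = 1 + (X + X)) :
    levi U U hU ∈ Subgroup.closure kernelGenerators := by
  obtain ⟨X, hX⟩ := h2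
  have hmem : levi U U hU ∈ principal 2 := by
    refine mem_principal_two_of_eq (X := fromBlocks X 0 0 Xᵀ) ?_
    simp only [levi, ← fromBlocks_one, fromBlocks_add, hX, transpose_add, transpose_one, add_zero]
  refine Subgroup.subset_closure (Or.inl (Or.inr ⟨mem_heckeKer_of_lowerSum hmem ?_,
    isConj_iff.2 ⟨levi V W hVW, ?_⟩⟩))
  · simp [lowerSum, levi]
  · rw [mul_inv_eq_iff_eq_mul]
    apply Subtype.ext
    change fromBlocks V 0 0 Wᵀ * fromBlocks (diagonal ![1, -1]) 0 0 (diagonal ![1, -1]) =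
      fromBlocks U 0 0 Uᵀ * fromBlocks V 0 0 Wᵀ
    have hVW' : V * W = 1 := mul_eq_one_comm.1 hVW
    have h : diagonal ![1, -1] * W = W * U := by
      calc diagonal ![1, -1] * W = W * (V * diagonal ![1, -1]) * W := by
            rw [← mul_assoc, hVW, one_mul]
        _ = W * U := by rw [← hUV, mul_assoc, mul_assoc, hVW', mul_one]
    have h' := congrArg transpose h
    rw [transpose_mul, transpose_mul, diagonal_transpose] at h'
    rw [fromBlocks_multiply, fromBlocks_multiply, hUV, ← h']
    simp only [mul_zero, zero_mul, add_zero, zero_add]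

/-- The element of `Γ₂` belonging to the reflection `(-1 0; 0 1)`. -/
def refl₁ : Gamma2 := levi !![-1, 0; 0, 1] !![-1, 0; 0, 1] (by decide)

/-- The element of `Γ₂` belonging to the reflection `(1 0; 0 -1)`. -/
def refl₂ : Gamma2 := levi !![1, 0; 0, -1] !![1, 0; 0, -1] (by decide)

/-- The element of `Γ₂` belonging to the reflection `(1 -2; 0 -1)`. -/
def refl₃ : Gamma2 := levi !![1, -2; 0, -1] !![1, -2; 0, -1] (by decide)

/-- The element of `Γ₂` belonging to the reflection `(1 0; -2 -1)`. -/
def refl₄ : Gamma2 := levi !![1, 0; -2, -1] !![1, 0; -2, -1] (by decide)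

lemma refl_mem : refl₁ ∈ Subgroup.closure kernelGenerators ∧
    refl₂ ∈ Subgroup.closure kernelGenerators ∧ refl₃ ∈ Subgroup.closure kernelGenerators ∧
    refl₄ ∈ Subgroup.closure kernelGenerators := by
  refine ⟨?_, ?_, ?_, ?_⟩
  · exact levi_mem_closure_kernelGenerators _ !![0, 1; 1, 0] !![0, 1; 1, 0] (by decide) _
      (by decide) ⟨!![-1, 0; 0, 0], by decide⟩
  · exact levi_mem_closure_kernelGenerators _ 1 1 (by decide) _
      (by decide) ⟨!![0, 0; 0, -1], by decide⟩
  · exact levi_mem_closure_kernelGenerators _ !![1, 1; 0, 1] !![1, -1; 0, 1] (by decide) _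
      (by decide) ⟨!![0, -1; 0, -1], by decide⟩
  · exact levi_mem_closure_kernelGenerators _ !![1, 0; -1, 1] !![1, 0; 1, 1] (by decide) _
      (by decide) ⟨!![0, 0; -1, -1], by decide⟩

/-- The upper left block of `g * M` modulo `4`, for `M` in `Γ₂[2]`. -/
lemma mul_inl_modEq {g M : Gamma2} (hg : g ∈ principal 2) (hM : M ∈ principal 2) (i j : Fin 2) :
    (g * M).1 (.inl i) (.inl j) ≡
      g.1 (.inl i) (.inl j) + M.1 (.inl i) (.inl j) - (1 : Matrix (Fin 2) (Fin 2) ℤ) i j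
      [ZMOD 4] := by
  have h := mul_apply_modEq hg hM (.inl i) (.inl j)
  rwa [← fromBlocks_one, fromBlocks_apply₁₁] at h

/-- Multiplication by reflections makes the upper left block congruent to `1` modulo `4`: first
the entries off the diagonal are corrected, then the diagonal ones. -/
lemma exists_mul_toBlocks₁₁_modEq_one {M : Gamma2} (hM : M ∈ principal 2) :
    ∃ g ∈ Subgroup.closure kernelGenerators, ∀ i j : Fin 2,
      (g * M).1 (.inl i) (.inl j) ≡ (1 : Matrix (Fin 2) (Fin 2) ℤ) i j [ZMOD 4] := by
  obtain ⟨hr1, hr2, hr3, hr4⟩ := refl_mem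
  have hle : Subgroup.closure kernelGenerators ≤ principal 2 := fun g hg =>
    (closure_kernelGenerators_le hg).1
  -- one correction step, for a reflection `r` or the unit element
  have pick : ∀ r ∈ Subgroup.closure kernelGenerators, ∀ i j : Fin 2,
      r.1 (.inl i) (.inl j) - (1 : Matrix (Fin 2) (Fin 2) ℤ) i j ≡ 2 [ZMOD 4] →
      ∀ N ∈ principal 2, ∃ g, (g = 1 ∨ g = r) ∧ (g * N).1 (.inl i) (.inl j) ≡
        (1 : Matrix (Fin 2) (Fin 2) ℤ) i j [ZMOD 4] := by
    intro r hr i j hrij N hN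
    have h2 : (2 : ℤ) ∣ N.1 (.inl i) (.inl j) - (1 : Matrix (Fin 2) (Fin 2) ℤ) i j := by
      have h := mem_principal_iff.1 hN (.inl i) (.inl j)
      rwa [← fromBlocks_one, fromBlocks_apply₁₁] at h
    by_cases h4 : N.1 (.inl i) (.inl j) ≡ (1 : Matrix (Fin 2) (Fin 2) ℤ) i j [ZMOD 4]
    · exact ⟨1, Or.inl rfl, by rwa [one_mul]⟩
    · refine ⟨r, Or.inr rfl, (mul_inl_modEq (hle hr) hN i j).trans ?_⟩
      simp only [Int.ModEq] at hrij h4 ⊢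
      omega
  have mem : ∀ {g r : Gamma2}, r ∈ Subgroup.closure kernelGenerators → g = 1 ∨ g = r →
      g ∈ Subgroup.closure kernelGenerators := by
    rintro g r hr (rfl | rfl)
    · exact one_mem _
    · exact hr
  -- a factor congruent to the unit matrix at a position does not change that position
  have keep : ∀ {g r N : Gamma2}, r ∈ Subgroup.closure kernelGenerators → (g = 1 ∨ g = r) →
      N ∈ principal 2 → ∀ i j : Fin 2, r.1 (.inl i) (.inl j) = (1 : Matrix (Fin 2) (Fin 2) ℤ) i j →
      N.1 (.inl i) (.inl j) ≡ (1 : Matrix (Fin 2) (Fin 2) ℤ) i j [ZMOD 4] →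
      (g * N).1 (.inl i) (.inl j) ≡ (1 : Matrix (Fin 2) (Fin 2) ℤ) i j [ZMOD 4] := by
    rintro g r N hr (rfl | rfl) hN i j hrij h
    · rwa [one_mul]
    · refine (mul_inl_modEq (hle hr) hN i j).trans ?_
      rw [hrij, add_sub_cancel_left]
      exact h
  obtain ⟨g3, hg3, h01⟩ := pick _ hr3 0 1 (by decide) M hM
  have hM3 := mul_mem (hle (mem hr3 hg3)) hM
  obtain ⟨g4, hg4, h10⟩ := pick _ hr4 1 0 (by decide) _ hM3
  have h01 := keep hr4 hg4 hM3 0 1 (by decide) h01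
  have hM4 := mul_mem (hle (mem hr4 hg4)) hM3
  obtain ⟨g1, hg1, h00⟩ := pick _ hr1 0 0 (by decide) _ hM4
  have h01 := keep hr1 hg1 hM4 0 1 (by decide) h01
  have h10 := keep hr1 hg1 hM4 1 0 (by decide) h10
  have hM1 := mul_mem (hle (mem hr1 hg1)) hM4
  obtain ⟨g2, hg2, h11⟩ := pick _ hr2 1 1 (by decide) _ hM1
  have h01 := keep hr2 hg2 hM1 0 1 (by decide) h01
  have h10 := keep hr2 hg2 hM1 1 0 (by decide) h10
  have h00 := keep hr2 hg2 hM1 0 0 (by decide) h00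
  refine ⟨g2 * (g1 * (g4 * g3)), mul_mem (mem hr2 hg2) (mul_mem (mem hr1 hg1)
    (mul_mem (mem hr4 hg4) (mem hr3 hg3))), ?_⟩
  simp only [mul_assoc]
  intro i j
  fin_cases i <;> fin_cases j
  exacts [h00, h01, h10, h11]

/-- For `A ≡ 1 mod 4` the relations between the blocks force `D ≡ 1` and the symmetry of `B` and
`C` modulo `4`; so `M` is congruent to a product of the two kinds of translations. -/
lemma mem_closure_kernelGenerators_of_toBlocks₁₁ {M : Gamma2} (hM : M ∈ kernel)
    (hA : ∀ i j : Fin 2,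
      M.1 (.inl i) (.inl j) ≡ (1 : Matrix (Fin 2) (Fin 2) ℤ) i j [ZMOD 4]) :
    M ∈ Subgroup.closure kernelGenerators := by
  have hM2 : M ∈ principal 2 := hM.1
  have hsum := (mem_Gamma_iff hM2).1 hM
  let f : ℤ →+* ZMod 4 := Int.castRingHom (ZMod 4)
  have hf : ∀ {x y : ℤ}, f x = f y ↔ x ≡ y [ZMOD 4] := ZMod.intCast_eq_intCast_iff _ _ 4
  obtain ⟨r1, r2, r3⟩ := block_relations M
  replace r1 := congrArg (fun N => N.map f) r1
  replace r2 := congrArg (fun N => N.map f) r2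
  replace r3 := congrArg (fun N => N.map f) (sub_eq_iff_eq_add.1 r3)
  simp only [Matrix.map_mul, transpose_map, Matrix.map_add f (map_add f)] at r1 r2 r3
  have hA' : M.1.toBlocks₁₁.map f = 1 := by
    ext i j
    refine (hf.2 (hA i j)).trans ?_
    rw [one_apply, one_apply]
    split <;> simp
  have heven : ∀ i j : Fin 2 ⊕ Fin 2, i ≠ j → ∃ x, M.1 i j = 2 * x := fun i j hij =>
    (even_off_diag_of_mem_principal hM2 hij).exists_two_nsmul _ |>.imp fun x hx => by
      rw [hx, nsmul_eq_mul]; rfl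
  choose c hc using fun i j : Fin 2 => heven (.inr i) (.inl j) Sum.inr_ne_inl
  choose b hb using fun i j : Fin 2 => heven (.inl i) (.inr j) Sum.inl_ne_inr
  have hCB : (M.1.toBlocks₂₁.map f)ᵀ * M.1.toBlocks₁₂.map f = 0 := by
    ext i j
    have h4 : ∀ x y : ℤ, f (2 * x) * f (2 * y) = 0 := fun x y => by
      rw [← map_mul, ← map_zero f, hf]
      exact Int.modEq_zero_iff_dvd.2 ⟨x * y, by ring⟩
    rw [mul_apply, Fin.sum_univ_two]
    change f (M.1 (.inr 0) (.inl i)) * f (M.1 (.inl 0) (.inr j)) +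
      f (M.1 (.inr 1) (.inl i)) * f (M.1 (.inl 1) (.inr j)) = 0
    rw [hc, hc, hb, hb, h4, h4, add_zero]
  rw [hA', transpose_one, one_mul, mul_one] at r1
  have hone : (1 : Matrix (Fin 2) (Fin 2) ℤ).map f = 1 := by simp
  rw [hA', transpose_one, one_mul, hCB, hone, add_zero] at r3
  rw [r3, transpose_one, one_mul, mul_one] at r2
  have hC : M.1 (.inr 1) (.inl 0) ≡ M.1 (.inr 0) (.inl 1) [ZMOD 4] :=
    hf.1 (congrFun (congrFun r1 1) 0)
  have hB : M.1 (.inl 1) (.inr 0) ≡ M.1 (.inl 0) (.inr 1) [ZMOD 4] :=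
    hf.1 (congrFun (congrFun r2.symm 1) 0)
  have hD : ∀ i j : Fin 2,
      M.1 (.inr i) (.inr j) ≡ (1 : Matrix (Fin 2) (Fin 2) ℤ) i j [ZMOD 4] := fun i j =>
    hf.1 ((congrFun (congrFun r3 i) j).trans (congrFun (congrFun hone i) j).symm)
  have heven_sum : Even (c 0 0 + c 0 1 + c 1 1) := by
    have := Int.modEq_zero_iff_dvd.1 hsum
    rw [lowerSum, hc, hc, hc] at this
    rw [Int.even_iff]
    omega
  have hu := upper_mem_principal (b 0 0) (b 0 1) (b 1 1)
  have hl := lower_mem_principal (c 0 0) (c 0 1) (c 1 1)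
  set g := upper (2 * b 0 0) (2 * b 0 1) (2 * b 1 1) * lower (2 * c 0 0) (2 * c 0 1) (2 * c 1 1)
    with hg
  have hgmem : g ∈ Subgroup.closure kernelGenerators :=
    mul_mem (upper_mem_closure_kernelGenerators _ _ _)
      (lower_mem_closure_kernelGenerators heven_sum)
  have hgM : ∀ i j, M.1 i j ≡ g.1 i j [ZMOD 4] := by
    intro i j
    refine Int.ModEq.trans ?_ (mul_apply_modEq hu hl i j).symm
    rw [← fromBlocks_one]
    rcases i with i | i <;> rcases j with j | j
    · simpa [upper, lower] using hA i j
    · fin_cases i <;> fin_cases j <;> simp [upper, lower, ← hb, hB, Int.ModEq.refl]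
    · fin_cases i <;> fin_cases j <;> simp [upper, lower, ← hc, hC, Int.ModEq.refl]
    · simpa [upper, lower] using hD i j
  have hquot : g⁻¹ * M ∈ principal 4 := by
    refine mem_principal_iff.2 fun i j => ?_
    have h := mul_apply_modEq (mul_mem hu hl) (mul_mem (inv_mem (mul_mem hu hl)) hM2) i j
    rw [← hg, mul_inv_cancel_left] at h
    have h' := (hgM i j).symm.trans h
    rw [add_sub_assoc] at h'
    simpa using Int.modEq_iff_dvd.1 h'
  have := mul_mem hgmem (Subgroup.subset_closure (Or.inl (Or.inl hquot)))
  rwa [mul_inv_cancel_left] at this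

theorem closure_kernelGenerators : Subgroup.closure kernelGenerators = kernel := by
  refine le_antisymm closure_kernelGenerators_le fun M hM => ?_
  obtain ⟨g, hg, hA⟩ := exists_mul_toBlocks₁₁_modEq_one hM.1
  have h := mem_closure_kernelGenerators_of_toBlocks₁₁
    (mul_mem (closure_kernelGenerators_le hg) hM) hA
  rwa [Subgroup.mul_mem_cancel_left _ hg] at h

end SiegelTwo

theorem lemma1p4 :
    (∀ M : SiegelTwo.Gamma2, M ∈ SiegelTwo.principal 2 →
      (M.1.toBlocks₂₁ * M.1.toBlocks₂₂.transpose).IsSymm ∧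
      (M ∈ SiegelTwo.Gamma SiegelTwo.standardSextuple ↔
        (M.1.toBlocks₂₁ * M.1.toBlocks₂₂.transpose) 0 0 +
          (M.1.toBlocks₂₁ * M.1.toBlocks₂₂.transpose) 0 1 +
          (M.1.toBlocks₂₁ * M.1.toBlocks₂₂.transpose) 1 1 ≡ 0 [ZMOD 4])) ∧
    (Subgroup.closure
      ((SiegelTwo.principal 4 : Set SiegelTwo.Gamma2) ∪
        {M | M ∈ SiegelTwo.heckeKer SiegelTwo.standardSextuple ∧
          IsConj SiegelTwo.diagElt M} ∪
        {M | M ∈ SiegelTwo.heckeKer SiegelTwo.standardSextuple ∧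
          ∃ N ∈ SiegelTwo.principal 2, SiegelTwo.IsTranslation N ∧ IsConj N M}) :
      Set SiegelTwo.Gamma2) = SiegelTwo.Gamma SiegelTwo.standardSextuple := by
  refine ⟨fun M hM => ⟨SiegelTwo.isSymm_mul_transpose M, ?_⟩, ?_⟩
  · rw [SiegelTwo.mem_Gamma_iff hM]
    exact ⟨(SiegelTwo.lowerSum_modEq hM).trans, (SiegelTwo.lowerSum_modEq hM).symm.trans⟩
  · exact congrArg SetLike.coe SiegelTwo.closure_kernelGenerators
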